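/- **Setting.** Let $q_0=(\tfrac1{\sqrt3},1)$, $q_1=(0,0)$, $q_2=(\tfrac2{\sqrt3},0)$, $F_i(z)=\tfrac12(z+q_i)$ for $i=0,1,2$, and let $\mathcal{SG}$ be the Sierpinski gasket, i.e. the unique nonempty compact set with $\mathcal{SG}=\bigcup_i F_i\mathcal{SG}$. Put $V_0=\{q_0,q_1,q_2\}$, $V_m=\bigcup_iF_iV_{m-1}$, $F_w=F_{w_1}\circ\cdots\circ F_{w_m}$ for $w\in\{0,1,2\}^m$, and $$\mathcal E_m(u,v)=\left(\tfrac53\right)^m\sum_{x\sim_m y}(u(x)-u(y))(v(x)-v(y)),$$ where the sum is over the unordered pairs of distinct vertices $x,y\in V_m$ lying in a common cell $F_w\mathcal{SG}$ with $|w|=m$. A continuous function $v$ on $\mathcal{SG}$ has finite energy if $\lim_m\mathcal E_m(v,v)<\infty$. A function $u$ is harmonic ($\Delta u=0$) in a relatively open set $\Omega\subseteq\mathcal{SG}$ if $\lim_m\mathcal E_m(u,v)=0$ for every continuous $v$ of finite energy whose support is a compact subset of $\Omega$. For $0\le\lambda<1$ let $\Omega_\lambda^-=\{(x,y)\in\mathcal{SG}\setminus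 V_0: y<1-\lambda\}$ and $X_\lambda=\{(x,y)\in\mathcal{SG}:y=1-\lambda\}$. Let $X_\lambda^-=X_\lambda$ if $\lambda$ is not a dyadic rational, and $X_\lambda^-=V_{d}\cap X_\lambda$ if $\lambda$ is a dyadic rational and $d$ is the smallest nonnegative integer such that $\lambda$ is an integer multiple of $2^{-d}$. Let $\partial\Omega_\lambda^-=X_\lambda^-\cup\{q_1,q_2\}$. Let $h_1^\lambda$ be the continuous function on $\Omega_\lambda^-\cup\partial\Omega_\lambda^-$ that is harmonic in $\Omega_\lambda^-$ with $h_1^\lambda(q_1)=1$, $h_1^\lambda(q_2)=0$ and $h_1^\lambda=0$ on $X_\lambda^-$. With the normal derivatives $$\partial_nu(q_i)=\lim_{m\to\infty}\left(\tfrac53\right)^m\big(2u(q_i)-u(F_i^mq_{i+1})-u(F_i^mq_{i-1})\big)$$ (indices modulo $3$), put $$\eta_1(\lambda)=\partial_nh_1^\lambda(q_1),\qquad \eta_2(\lambda)=-\partial_nh_1^\lambda(q_2).$$ Write $\lambda=\sum_{k\ge1}e_k(\lambda)2^{-k}$ with $e_k(\lambda)\in\{0,1\}$ not eventually equal to $1$,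 and $S\lambda=\sum_{k\ge1}e_{k+1}(\lambda)2^{-k}$. **Theorem 4.7.** For every $0\le\lambda<1$ the function $h_1^\lambda$ exists and is unique, and its normal derivatives at $q_1$ and $q_2$ exist, so that $\eta_1,\eta_2$ are well defined on $[0,1)$. Moreover: (a) On $[0,1)$, $\eta_1$ is continuous and strictly increasing in $\lambda$, and $\eta_2$ is continuous and strictly decreasing in $\lambda$. (b) For $0\le\lambda<1$, $\big(\eta_1(\lambda),\eta_2(\lambda)\big)=T_{e_1(\lambda)}\big(\eta_1(S\lambda),\eta_2(S\lambda)\big)$, where $$T_0(x,y)=\Big(\tfrac56\cdot\tfrac{3+2x+2y}{2+x+y}+\tfrac52\cdot\tfrac{x-y}{3+2x-2y},\ \tfrac56\cdot\tfrac{3+2x+2y}{2+x+y}-\tfrac52\cdot\tfrac{x-y}{3+2x-2y}\Big),$$ $$T_1(x,y)=\Big(\tfrac53\big(x-\tfrac{y^2}{2x}\big),\ \tfrac{5y^2}{6x}\Big).$$ In addition, for any fixed real numbers $c_1>c_2>0$, $$\big(\eta_1(\lambda),\eta_2(\lambda)\big)=\lim_{m\to\infty}T_{e_1(\lambda)}\circ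 T_{e_2(\lambda)}\circ\cdots\circ T_{e_m(\lambda)}(c_1,c_2).$$ -/

import Mathlib

open Set Filter Topology

namespace SierpinskiLower

noncomputable section

/-- The vertices `q₀ = (1/√3, 1)`, `q₁ = (0, 0)`, `q₂ = (2/√3, 0)` of an equilateral triangle. -/
def q : Fin 3 → ℝ × ℝ :=
  ![(1 / Real.sqrt 3, 1), (0, 0), (2 / Real.sqrt 3, 0)]

/-- The contraction `F_i` of ratio `1/2` with fixed point `q_i`. -/
def F (i : Fin 3) (z : ℝ × ℝ) : ℝ × ℝ := (1 / 2 : ℝ) • z + (1 / 2 : ℝ) • q i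

/-- `F_w = F_{w_1} ∘ ⋯ ∘ F_{w_m}` for a word `w` of length `m` (`w_k` is `w (k - 1)`). -/
def Fw : (m : ℕ) → (Fin m → Fin 3) → ℝ × ℝ → ℝ × ℝ
  | 0, _ => id
  | m + 1, w => F (w 0) ∘ Fw m (Fin.tail w)

/-- The vertex sets `V_0 = {q₀, q₁, q₂}` and `V_{m+1} = ⋃ i, F_i V_m`. -/
def V : ℕ → Set (ℝ × ℝ)
  | 0 => range q
  | m + 1 => ⋃ i, F i '' V m

/-- The Sierpinski gasket: the closure of the set `V_* = ⋃ m, V_m` of all vertices. -/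
def SG : Set (ℝ × ℝ) := closure (⋃ m, V m)

/-- The graph energy `𝓔_m(u, v) = (5/3)^m ∑_{x ∼_m y} (u(x) - u(y)) (v(x) - v(y))`. Each edge of the
level-`m` graph belongs to exactly one `m`-cell `F_w SG`, so the sum over edges is written as a sum
over words `w` of length `m` and over the three pairs of corners `F_w q_i`, `F_w q_{i+1}`. -/
def graphEnergy (m : ℕ) (u v : ℝ × ℝ → ℝ) : ℝ :=
  (5 / 3 : ℝ) ^ m * ∑ w : Fin m → Fin 3, ∑ i : Fin 3,
    (u (Fw m w (q i)) - u (Fw m w (q (i + 1)))) * (v (Fw m w (q i)) - v (Fw m w (q (i + 1))))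

/-- `v` is a continuous function on the gasket of finite energy (the graph energies `𝓔_m(v, v)`
are nondecreasing in `m`, so their limit is finite iff they are bounded). -/
def InDomEnergy (v : ℝ × ℝ → ℝ) : Prop :=
  ContinuousOn v SG ∧ BddAbove (range fun m => graphEnergy m v v)

/-- `Δ u = 0` in the relatively open subset `Ω` of the gasket, in the weak sense: the energy
`𝓔(u, v) = lim 𝓔_m(u, v)` vanishes for all finite-energy `v` with compact support in `Ω`.
Values of `u` outside `Ω` do not influence the limit. -/
def IsHarmonicIn (Ω : Set (ℝ × ℝ)) (u : ℝ × ℝ → ℝ) : Prop :=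
  ∀ v : ℝ × ℝ → ℝ, InDomEnergy v →
    (∃ K, IsCompact K ∧ K ⊆ Ω ∧ ∀ x ∈ SG \ K, v x = 0) →
      Tendsto (fun m => graphEnergy m u v) atTop (𝓝 0)

/-- The lower domain `Ω_t⁻ = {(x, y) ∈ SG \ V_0 : y < 1 - t}`. -/
def lowerDomain (t : ℝ) : Set (ℝ × ℝ) := {z | z ∈ SG \ V 0 ∧ z.2 < 1 - t}

/-- The horizontal cut `X_t = {(x, y) ∈ SG : y = 1 - t}`. -/
def cut (t : ℝ) : Set (ℝ × ℝ) := {z | z ∈ SG ∧ z.2 = 1 - t}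

/-- The exponents `d` such that `t` is an integer multiple of `2^{-d}`. -/
def dyadicLevels (t : ℝ) : Set ℕ := {d | ∃ k : ℤ, t = k / 2 ^ d}

open Classical in
/-- The upper part `X_t⁻` of the boundary of the lower domain: `V_{d(t)} ∩ X_t` if `t` is a dyadic
rational, where `d(t)` is the least `d` such that `t` is a multiple of `2^{-d}`, and `X_t` if
not. -/
def lowerCut (t : ℝ) : Set (ℝ × ℝ) :=
  if (dyadicLevels t).Nonempty then V (sInf (dyadicLevels t)) ∩ cut t else cut t

/-- The boundary `∂Ω_t⁻ = X_t⁻ ∪ {q₁, q₂}`. -/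
def lowerBoundary (t : ℝ) : Set (ℝ × ℝ) := lowerCut t ∪ {q 1, q 2}

/-- The closed lower domain `Ω_t⁻ ∪ ∂Ω_t⁻`. -/
def closedLowerDomain (t : ℝ) : Set (ℝ × ℝ) := lowerDomain t ∪ lowerBoundary t

/-- `u` solves the Dirichlet problem `Δ u = 0` in `Ω_t⁻`, `u = f` on `∂Ω_t⁻`; it is continuous on
the closed domain. -/
structure IsDirichletSolution (t : ℝ) (f u : ℝ × ℝ → ℝ) : Prop where
  continuousOn : ContinuousOn u (closedLowerDomain t)
  harmonic : IsHarmonicIn (lowerDomain t) u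
  boundary : EqOn u f (lowerBoundary t)

/-- `h` solves the Dirichlet problem whose boundary values are `1` at `q₁` and `0` at `q₂` and
on `X_t⁻`. -/
def IsH₁ (t : ℝ) (h : ℝ × ℝ → ℝ) : Prop :=
  IsDirichletSolution t (indicator {q 1} 1) h

/-- The harmonic function `h₁^t`. -/
def h₁ (t : ℝ) : ℝ × ℝ → ℝ := Classical.epsilon (IsH₁ t)

/-- The difference quotients `(5/3)^m (2 u(q_i) - u(F_i^m q_{i+1}) - u(F_i^m q_{i-1}))`
(cyclic indices) at a corner `q_i`. -/
def normalQuotient (u : ℝ × ℝ → ℝ) (i : Fin 3) (m : ℕ) : ℝ :=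
  (5 / 3 : ℝ) ^ m * (2 * u (q i) - u ((F i)^[m] (q (i + 1))) - u ((F i)^[m] (q (i - 1))))

/-- The normal derivative of `u` at `q_i` exists and equals `a`. -/
def HasNormalDeriv (u : ℝ × ℝ → ℝ) (i : Fin 3) (a : ℝ) : Prop :=
  Tendsto (normalQuotient u i) atTop (𝓝 a)

/-- The normal derivative of `u` at `q_i` (an arbitrary value if it does not exist). -/
def normalDeriv (u : ℝ × ℝ → ℝ) (i : Fin 3) : ℝ := limUnder atTop (normalQuotient u i)

/-- `η₁(t)` is the normal derivative of `h₁^t` at `q₁`. -/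
def η₁ (t : ℝ) : ℝ := normalDeriv (h₁ t) 1

/-- `η₂(t)` is minus the normal derivative of `h₁^t` at `q₂`. -/
def η₂ (t : ℝ) : ℝ := -normalDeriv (h₁ t) 2

/-- The binary digit `e_{k+1}(t)` of `t ∈ [0, 1)`, that is `⌊2^{k+1} t⌋` modulo `2`: the digits
of the binary expansion that does not end in `1`s. The index starts at `0` here, so that the first
digit `e_1(t)` is `digit t 0`. -/
def digit (t : ℝ) (k : ℕ) : Fin 2 := Real.digits t 2 k

/-- The shift `S t = ∑_{k ≥ 1} e_{k+1}(t) 2^{-k}`. -/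
def S (t : ℝ) : ℝ := Real.ofDigits fun k => digit t (k + 1)

/-- The rational map `T_0`. -/
def T₀ (p : ℝ × ℝ) : ℝ × ℝ :=
  (5 / 6 * ((3 + 2 * p.1 + 2 * p.2) / (2 + p.1 + p.2))
      + 5 / 2 * ((p.1 - p.2) / (3 + 2 * p.1 - 2 * p.2)),
    5 / 6 * ((3 + 2 * p.1 + 2 * p.2) / (2 + p.1 + p.2))
      - 5 / 2 * ((p.1 - p.2) / (3 + 2 * p.1 - 2 * p.2)))

/-- The rational map `T_1`. -/
def T₁ (p : ℝ × ℝ) : ℝ × ℝ :=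
  (5 / 3 * (p.1 - p.2 ^ 2 / (2 * p.1)), 5 * p.2 ^ 2 / (6 * p.1))

/-- `T_0` and `T_1` as a family indexed by a binary digit. -/
def T (e : Fin 2) : ℝ × ℝ → ℝ × ℝ := if e = 0 then T₀ else T₁

/-- The composition `T_{e_1(t)} ∘ T_{e_2(t)} ∘ ⋯ ∘ T_{e_m(t)}`. -/
def Tcomp (t : ℝ) : ℕ → ℝ × ℝ → ℝ × ℝ
  | 0 => id
  | m + 1 => Tcomp t m ∘ T (digit t m)

end

end SierpinskiLower

open SierpinskiLower

/-!
The gasket and the lower domains are self-similar: the lower domain of `t` consists of a scaled lower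
domain of the shift `S t`, in the upper cell, and of two full cells if the first binary digit of `t`
is `0`, and of two scaled lower domains of `S t` in the lower cells if that digit is `1`. A function
that is harmonic in the lower domain, vanishes on the cut, and has the values `a`, `b` at `q₁`, `q₂`
has normal derivatives `η₁ a - η₂ b` and `η₁ b - η₂ a` there. Balancing the normal derivatives at
the junction points, as in an electrical network, expresses the values at these points and the
numbers `η₁ t`, `η₂ t` through `η₁ (S t)`, `η₂ (S t)`; the latter relation is `T₀` or `T₁`.

The proof runs this argument backwards. A limit `etaLim t` of `T_{e_1} ∘ ⋯ ∘ T_{e_m} (2, 1)` exists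
by monotonicity (`Tcomp_two_one_mono`). In the coordinates `x + y`, `x - y` the map `T₁` is
homogeneous and monotone, so that it does not increase ratios (`RatioClose.T₁`), while `T₀` contracts
them by a fixed factor (`RatioClose.T₀`). As `t` has infinitely many digits `0`, the limit does not
depend on the starting point (`tendsto_Tcomp`), and it is continuous in `t` (`continuousOn_etaLim`),
where left continuity at dyadic points comes from `T₀ p → T₁ (2, 1)` as `p → ∞`. Strict monotonicity
(`etaLim_strictMono`) follows by comparing at the first differing digit, because `T₀` and `T₁` are
strictly monotone for the order that is increasing in `x` and decreasing in `y`.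

With `etaLim` at hand, the solution is built cell by cell as the uniform limit of the functions
`Datum.approx`. Each digit `0` shrinks the values near the cut by `3/5`, which gives continuity up to
the cut. The graph energy of the solution with a test function is computed by recursion over the
cells (`Datum.graphEnergy_low`); only the boundary terms at `q₁` and `q₂` survive, whence
harmonicity (`isH₁_low`). The normal quotients are eventually constant
(`Datum.normalQuotient_low_one`).

Uniqueness is the comparison principle `IsDirichletSolution.le`: the harmonic spline through the
values of `(w - ε)⁺`, with `w` the difference of two solutions, is an admissible test function, and
it shows that `(w - ε)⁺` has no energy on any fine graph.
-/

namespace SierpinskiLower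

/-! ### Binary digits and the shift -/

lemma digit_zero_of_lt {t : ℝ} (h : t < 1 / 2) : digit t 0 = 0 := by
  have : ⌊t * 2 ^ (0 + 1)⌋₊ = 0 := by
    rw [Nat.floor_eq_zero]; norm_num; linarith
  simp only [digit, Real.digits]
  simp only [Nat.cast_ofNat, this]
  rfl

lemma digit_zero_of_ge {t : ℝ} (h : 1 / 2 ≤ t) (h1 : t < 1) : digit t 0 = 1 := by
  have : ⌊t * 2 ^ (0 + 1)⌋₊ = 1 := by
    rw [Nat.floor_eq_iff (by norm_num; linarith)]
    constructor <;> norm_num <;> linarith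
  simp only [digit, Real.digits]
  simp only [Nat.cast_ofNat, this]
  rfl

lemma S_eq {t : ℝ} (ht : t ∈ Ico (0 : ℝ) 1) : S t = 2 * t - (digit t 0 : ℕ) := by
  have h := Real.ofDigits_digits (b := 2) one_lt_two ht
  rw [Real.ofDigits_eq_sum_add_ofDigits _ 1] at h
  simp only [Finset.range_one, Finset.sum_singleton, Real.ofDigitsTerm] at h
  have h2 : S t = Real.ofDigits fun i => Real.digits t 2 (i + 1) := rfl
  rw [← h2] at h
  have h3 : (digit t 0 : ℕ) = (Real.digits t 2 0 : ℕ) := rfl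
  rw [h3]
  norm_num at h
  linarith

lemma S_of_lt {t : ℝ} (h0 : 0 ≤ t) (h : t < 1 / 2) : S t = 2 * t := by
  rw [S_eq ⟨h0, by linarith⟩, digit_zero_of_lt h]; simp

lemma S_of_ge {t : ℝ} (h : 1 / 2 ≤ t) (h1 : t < 1) : S t = 2 * t - 1 := by
  rw [S_eq ⟨by linarith, h1⟩, digit_zero_of_ge h h1]; simp

lemma S_mem {t : ℝ} (ht : t ∈ Ico (0 : ℝ) 1) : S t ∈ Ico (0 : ℝ) 1 := by
  rcases lt_or_ge t (1 / 2) with h | h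
  · rw [S_of_lt ht.1 h]; constructor <;> linarith [ht.1]
  · rw [S_of_ge h ht.2]; constructor <;> linarith [ht.2]

lemma digit_S {t : ℝ} (ht : t ∈ Ico (0 : ℝ) 1) (k : ℕ) : digit (S t) k = digit t (k + 1) := by
  rcases lt_or_ge t (1 / 2) with h | h
  · rw [S_of_lt ht.1 h]
    simp only [digit, Real.digits]
    congr 2
    push_cast
    ring
  · rw [S_of_ge h ht.2]
    simp only [digit, Real.digits]
    have : ⌊(2 * t - 1) * ((2 : ℕ) : ℝ) ^ (k + 1)⌋₊
        = ⌊t * ((2 : ℕ) : ℝ) ^ (k + 1 + 1)⌋₊ - 2 ^ (k + 1) := by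
      rw [← Nat.floor_sub_natCast]
      congr 1
      push_cast
      ring
    rw [this]
    have hle : 2 ^ (k + 1) ≤ ⌊t * ((2 : ℕ) : ℝ) ^ (k + 1 + 1)⌋₊ := by
      rw [Nat.le_floor_iff (by have := ht.1; positivity)]
      push_cast
      have : (0 : ℝ) < 2 ^ (k + 1) := by positivity
      rw [pow_succ _ (k + 1)]
      nlinarith
    apply Fin.ext
    simp only [Fin.ofNat]
    have : 2 ^ (k + 1) = 2 * 2 ^ k := by ring
    omega

/-- Induction along the leading run of digits `1` of `t`, which is finite. -/
lemma leadingOnes_induction {P : ℝ → Prop} (h0 : ∀ t, 0 ≤ t → t < 1 / 2 → P t)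
    (h1 : ∀ t, 1 / 2 ≤ t → t < 1 → P (S t) → P t) : ∀ t ∈ Ico (0 : ℝ) 1, P t := by
  have key : ∀ n : ℕ, ∀ t : ℝ, 0 ≤ t → t < 1 - (1 / 2) ^ n → P t := by
    intro n
    induction n with
    | zero => intro t h h'; norm_num at h'; linarith
    | succ n ih =>
      intro t h h'
      have hp : (0 : ℝ) < (1 / 2) ^ n := by positivity
      rw [pow_succ] at h'
      rcases lt_or_ge t (1 / 2) with h2 | h2
      · exact h0 t h h2
      · have ht1 : t < 1 := by linarith
        refine h1 t h2 ht1 (ih _ (S_mem ⟨h, ht1⟩).1 ?_)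
        rw [S_of_ge h2 ht1]; linarith
  intro t ht
  obtain ⟨n, hn⟩ := exists_pow_lt_of_lt_one (sub_pos.2 ht.2) (by norm_num : (1 / 2 : ℝ) < 1)
  exact key n t ht.1 (by linarith)

/-- The number of digits `0` among the first `m` digits of `t`. -/
noncomputable def zeroCount : ℝ → ℕ → ℕ
  | _, 0 => 0
  | t, m + 1 => (if t < 1 / 2 then 1 else 0) + zeroCount (S t) m

lemma zeroCount_unbounded (k : ℕ) : ∀ t ∈ Ico (0 : ℝ) 1, ∃ m, k ≤ zeroCount t m := by
  induction k with
  | zero => exact fun t _ => ⟨0, Nat.zero_le _⟩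
  | succ k ih =>
    apply leadingOnes_induction
    · intro t h h'
      obtain ⟨m, hm⟩ := ih (S t) (S_mem ⟨h, by linarith⟩)
      refine ⟨m + 1, ?_⟩
      simp only [zeroCount, h', if_true]
      omega
    · rintro t h h' ⟨m, hm⟩
      refine ⟨m + 1, ?_⟩
      simp only [zeroCount, not_lt.2 h, if_false]
      omega

lemma zeroCount_mono (t : ℝ) : Monotone (zeroCount t) := by
  refine monotone_nat_of_le_succ fun m => ?_
  induction m generalizing t with
  | zero => simp [zeroCount]
  | succ m ih =>
    have := ih (S t)
    rw [zeroCount, zeroCount]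
    omega

/-! ### The maps `T₀` and `T₁` -/

lemma T_zero : T 0 = T₀ := by simp [T]

lemma T_one : T 1 = T₁ := by simp [T]

lemma T_digit_of_lt {t : ℝ} (h : t < 1 / 2) : T (digit t 0) = T₀ := by
  rw [digit_zero_of_lt h, T_zero]

lemma T_digit_of_ge {t : ℝ} (h : 1 / 2 ≤ t) (h1 : t < 1) : T (digit t 0) = T₁ := by
  rw [digit_zero_of_ge h h1, T_one]

lemma Tcomp_succ {t : ℝ} (ht : t ∈ Ico (0 : ℝ) 1) (m : ℕ) (p : ℝ × ℝ) :
    Tcomp t (m + 1) p = T (digit t 0) (Tcomp (S t) m p) := by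
  induction m generalizing p with
  | zero => simp [Tcomp]
  | succ m ih =>
    rw [Tcomp, Function.comp_apply, ih, Tcomp, Function.comp_apply, digit_S ht]

/-- The region `y ≥ 0`, `x - y ≥ d`, in which all the orbits considered stay. -/
def Admissible (d : ℝ) (p : ℝ × ℝ) : Prop := 0 ≤ p.2 ∧ d ≤ p.1 - p.2

lemma T₀_add (p : ℝ × ℝ) : (T₀ p).1 + (T₀ p).2
    = 5 / 3 * ((3 + 2 * (p.1 + p.2)) / (2 + (p.1 + p.2))) := by
  simp only [T₀]
  rw [show 3 + 2 * p.1 + 2 * p.2 = 3 + 2 * (p.1 + p.2) by ring, add_assoc 2 p.1 p.2]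
  ring

lemma T₀_sub (p : ℝ × ℝ) : (T₀ p).1 - (T₀ p).2
    = 5 * ((p.1 - p.2) / (3 + 2 * (p.1 - p.2))) := by
  simp only [T₀]
  rw [show 3 + 2 * p.1 - 2 * p.2 = 3 + 2 * (p.1 - p.2) by ring]
  ring

lemma T₁_add (p : ℝ × ℝ) : (T₁ p).1 + (T₁ p).2 = 5 / 6 * ((p.1 + p.2) + (p.1 - p.2)) := by
  simp only [T₁]
  ring

lemma T₁_sub {p : ℝ × ℝ} (hp : p.1 ≠ 0) : (T₁ p).1 - (T₁ p).2
    = 10 / 3 * ((p.1 + p.2) * (p.1 - p.2) / ((p.1 + p.2) + (p.1 - p.2))) := by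
  simp only [T₁]
  have : (p.1 + p.2) + (p.1 - p.2) = 2 * p.1 := by ring
  rw [this]
  field_simp
  ring

lemma Admissible.mono {d d' : ℝ} {p : ℝ × ℝ} (h : Admissible d p) (hd : d' ≤ d) :
    Admissible d' p := ⟨h.1, hd.trans h.2⟩

lemma T₀_admissible {d : ℝ} (hd : 0 < d) (hd1 : d ≤ 1) {p : ℝ × ℝ} (hp : Admissible d p) :
    Admissible d (T₀ p) := by
  obtain ⟨h1, h2⟩ := hp
  refine ⟨?_, ?_⟩
  · have e1 : 5 / 4 ≤ 5 / 6 * ((3 + 2 * p.1 + 2 * p.2) / (2 + p.1 + p.2)) := by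
      rw [← mul_div_assoc, le_div_iff₀ (by linarith)]
      nlinarith
    have e2 : 5 / 2 * ((p.1 - p.2) / (3 + 2 * p.1 - 2 * p.2)) ≤ 5 / 4 := by
      rw [← mul_div_assoc, div_le_iff₀ (by linarith)]
      nlinarith
    simp only [T₀]
    linarith
  · rw [T₀_sub, ← mul_div_assoc, le_div_iff₀ (by linarith)]
    nlinarith

lemma T₁_admissible {d : ℝ} (hd : 0 < d) {p : ℝ × ℝ} (hp : Admissible d p) :
    Admissible (5 / 3 * d) (T₁ p) := by
  obtain ⟨h1, h2⟩ := hp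
  have hx : 0 < p.1 := by linarith
  refine ⟨by simp only [T₁]; positivity, ?_⟩
  rw [T₁_sub hx.ne', ← mul_div_assoc, le_div_iff₀ (by linarith)]
  nlinarith

lemma T_admissible {d : ℝ} (hd : 0 < d) (hd1 : d ≤ 1) {p : ℝ × ℝ} (hp : Admissible d p)
    (e : Fin 2) : Admissible d (T e p) := by
  fin_cases e
  · simpa [T_zero] using T₀_admissible hd hd1 hp
  · simpa [T_one] using (T₁_admissible hd hp).mono (by linarith)

lemma Tcomp_admissible {d : ℝ} (hd : 0 < d) (hd1 : d ≤ 1) (t : ℝ) (m : ℕ) {p : ℝ × ℝ}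
    (hp : Admissible d p) : Admissible d (Tcomp t m p) := by
  induction m generalizing p with
  | zero => exact hp
  | succ m ih => exact ih (T_admissible hd hd1 hp _)

/-- `T₀ p` is `(α + β, α - β)`, where `α` depends on `p.1 + p.2` and `β` on `p.1 - p.2`. When `p.1`
increases and `p.2` decreases, the increment of `β` dominates that of `α`. -/
lemma T₀_parts_compare {p p' : ℝ × ℝ} (hp : Admissible 1 p) (hp' : Admissible 1 p')
    (h1 : p.1 ≤ p'.1) (h2 : p'.2 ≤ p.2) :
    |5 / 6 * ((3 + 2 * p'.1 + 2 * p'.2) / (2 + p'.1 + p'.2))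
        - 5 / 6 * ((3 + 2 * p.1 + 2 * p.2) / (2 + p.1 + p.2))|
      ≤ 1 / 2 * (5 / 2 * ((p'.1 - p'.2) / (3 + 2 * p'.1 - 2 * p'.2))
        - 5 / 2 * ((p.1 - p.2) / (3 + 2 * p.1 - 2 * p.2))) ∧
    (p.1 < p'.1 → 5 / 2 * ((p.1 - p.2) / (3 + 2 * p.1 - 2 * p.2))
      < 5 / 2 * ((p'.1 - p'.2) / (3 + 2 * p'.1 - 2 * p'.2))) := by
  obtain ⟨a1, a2⟩ := hp
  obtain ⟨b1, b2⟩ := hp'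
  have k1 : 0 < 2 + p.1 + p.2 := by linarith
  have k2 : 0 < 2 + p'.1 + p'.2 := by linarith
  have k3 : 0 < 3 + 2 * p.1 - 2 * p.2 := by linarith
  have k4 : 0 < 3 + 2 * p'.1 - 2 * p'.2 := by linarith
  have eB : 5 / 2 * ((p'.1 - p'.2) / (3 + 2 * p'.1 - 2 * p'.2))
        - 5 / 2 * ((p.1 - p.2) / (3 + 2 * p.1 - 2 * p.2))
      = 15 / 2 * ((p'.1 - p.1 + (p.2 - p'.2)) /
        ((3 + 2 * p.1 - 2 * p.2) * (3 + 2 * p'.1 - 2 * p'.2))) := by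
    field_simp
    ring
  have eA : 5 / 6 * ((3 + 2 * p'.1 + 2 * p'.2) / (2 + p'.1 + p'.2))
        - 5 / 6 * ((3 + 2 * p.1 + 2 * p.2) / (2 + p.1 + p.2))
      = 5 / 6 * ((p'.1 - p.1 - (p.2 - p'.2)) / ((2 + p.1 + p.2) * (2 + p'.1 + p'.2))) := by
    field_simp
    ring
  refine ⟨?_, fun h => ?_⟩
  · rw [eA, eB, abs_mul, abs_of_pos (by norm_num : (0 : ℝ) < 5 / 6), abs_div,
      abs_of_pos (mul_pos k1 k2)]
    have n1 : |p'.1 - p.1 - (p.2 - p'.2)| ≤ p'.1 - p.1 + (p.2 - p'.2) := by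
      rw [abs_le]; constructor <;> linarith
    have n2 : (3 + 2 * p.1 - 2 * p.2) * (3 + 2 * p'.1 - 2 * p'.2)
        ≤ (2 * (2 + p.1 + p.2)) * (2 * (2 + p'.1 + p'.2)) :=
      mul_le_mul (by linarith) (by linarith) k4.le (by linarith)
    have n3 : |p'.1 - p.1 - (p.2 - p'.2)| / ((2 + p.1 + p.2) * (2 + p'.1 + p'.2))
        ≤ 4 * ((p'.1 - p.1 + (p.2 - p'.2)) /
          ((3 + 2 * p.1 - 2 * p.2) * (3 + 2 * p'.1 - 2 * p'.2))) := by
      rw [← mul_div_assoc, div_le_div_iff₀ (mul_pos k1 k2) (mul_pos k3 k4)]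
      calc _ ≤ (p'.1 - p.1 + (p.2 - p'.2)) * ((2 * (2 + p.1 + p.2)) * (2 * (2 + p'.1 + p'.2))) :=
            mul_le_mul n1 n2 (mul_pos k3 k4).le (by linarith)
        _ = _ := by ring
    have n4 : 0 ≤ (p'.1 - p.1 + (p.2 - p'.2)) /
          ((3 + 2 * p.1 - 2 * p.2) * (3 + 2 * p'.1 - 2 * p'.2)) :=
      div_nonneg (by linarith) (mul_pos k3 k4).le
    linarith
  · rw [← sub_pos, eB]
    have : 0 < p'.1 - p.1 + (p.2 - p'.2) := by linarith
    positivity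

lemma T₀_mono {p p' : ℝ × ℝ} (hp : Admissible 1 p) (hp' : Admissible 1 p')
    (h1 : p.1 ≤ p'.1) (h2 : p'.2 ≤ p.2) : (T₀ p).1 ≤ (T₀ p').1 ∧ (T₀ p').2 ≤ (T₀ p).2 := by
  have h := (T₀_parts_compare hp hp' h1 h2).1
  have h0 := abs_nonneg (5 / 6 * ((3 + 2 * p'.1 + 2 * p'.2) / (2 + p'.1 + p'.2))
        - 5 / 6 * ((3 + 2 * p.1 + 2 * p.2) / (2 + p.1 + p.2)))
  have h3 := abs_le.1 h
  simp only [T₀]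
  constructor <;> linarith [h3.1, h3.2]

lemma T₀_strictMono {p p' : ℝ × ℝ} (hp : Admissible 1 p) (hp' : Admissible 1 p')
    (h1 : p.1 < p'.1) (h2 : p'.2 < p.2) : (T₀ p).1 < (T₀ p').1 ∧ (T₀ p').2 < (T₀ p).2 := by
  have h := (T₀_parts_compare hp hp' h1.le h2.le).1
  have h' := (T₀_parts_compare hp hp' h1.le h2.le).2 h1
  have h3 := abs_le.1 h
  simp only [T₀]
  constructor <;> linarith [h3.1, h3.2]

lemma T₁_mono {p p' : ℝ × ℝ} (hp : Admissible 1 p) (hp' : Admissible 1 p')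
    (h1 : p.1 ≤ p'.1) (h2 : p'.2 ≤ p.2) : (T₁ p).1 ≤ (T₁ p').1 ∧ (T₁ p').2 ≤ (T₁ p).2 := by
  obtain ⟨a1, a2⟩ := hp
  obtain ⟨b1, b2⟩ := hp'
  have hx : 0 < p.1 := by linarith
  have h : p'.2 ^ 2 / p'.1 ≤ p.2 ^ 2 / p.1 := by gcongr
  have e1 : p.2 ^ 2 / (2 * p.1) = 1 / 2 * (p.2 ^ 2 / p.1) := by field_simp
  have e2 : p'.2 ^ 2 / (2 * p'.1) = 1 / 2 * (p'.2 ^ 2 / p'.1) := by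
    rw [div_mul_eq_div_div_swap]; ring
  have e3 : 5 * p.2 ^ 2 / (6 * p.1) = 5 / 6 * (p.2 ^ 2 / p.1) := by field_simp
  have e4 : 5 * p'.2 ^ 2 / (6 * p'.1) = 5 / 6 * (p'.2 ^ 2 / p'.1) := by
    rw [mul_div_mul_comm]
  simp only [T₁, e1, e2, e3, e4]
  constructor <;> linarith

lemma T₁_strictMono {p p' : ℝ × ℝ} (hp : Admissible 1 p) (hp' : Admissible 1 p')
    (h1 : p.1 < p'.1) (h2 : p'.2 < p.2) : (T₁ p).1 < (T₁ p').1 ∧ (T₁ p').2 < (T₁ p).2 := by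
  obtain ⟨a1, a2⟩ := hp
  obtain ⟨b1, b2⟩ := hp'
  have hx : 0 < p.1 := by linarith
  have h : p'.2 ^ 2 / p'.1 < p.2 ^ 2 / p.1 := by gcongr
  have e1 : p.2 ^ 2 / (2 * p.1) = 1 / 2 * (p.2 ^ 2 / p.1) := by field_simp
  have e2 : p'.2 ^ 2 / (2 * p'.1) = 1 / 2 * (p'.2 ^ 2 / p'.1) := by
    rw [div_mul_eq_div_div_swap]; ring
  have e3 : 5 * p.2 ^ 2 / (6 * p.1) = 5 / 6 * (p.2 ^ 2 / p.1) := by field_simp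
  have e4 : 5 * p'.2 ^ 2 / (6 * p'.1) = 5 / 6 * (p'.2 ^ 2 / p'.1) := by
    rw [mul_div_mul_comm]
  simp only [T₁, e1, e2, e3, e4]
  constructor <;> linarith

lemma admissible_two_one : Admissible 1 (2, 1) := by constructor <;> norm_num

lemma T₀_two_one : T₀ (2, 1) = (2, 1) := by ext <;> norm_num [T₀]

lemma T₁_two_one : T₁ (2, 1) = (35 / 12, 5 / 12) := by ext <;> norm_num [T₁]

/-- `(35/12, 5/12)` is the value of `η` at `t = 1/2`, and a strict bound for its values on
`[0, 1/2)`. -/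
lemma T₀_bound {p : ℝ × ℝ} (hp : Admissible 1 p) : (T₀ p).1 < 35 / 12 ∧ 5 / 12 < (T₀ p).2 := by
  obtain ⟨a1, a2⟩ := hp
  have k1 : 0 < 2 + p.1 + p.2 := by linarith
  have k3 : 0 < 3 + 2 * p.1 - 2 * p.2 := by linarith
  have eA : 5 / 6 * ((3 + 2 * p.1 + 2 * p.2) / (2 + p.1 + p.2))
      = 5 / 3 - 5 / 6 * (1 / (2 + p.1 + p.2)) := by field_simp; ring
  have eB : 5 / 2 * ((p.1 - p.2) / (3 + 2 * p.1 - 2 * p.2))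
      = 5 / 4 - 15 / 4 * (1 / (3 + 2 * p.1 - 2 * p.2)) := by field_simp; ring
  have h1 : 0 < 1 / (2 + p.1 + p.2) := by positivity
  have h2 : 0 < 1 / (3 + 2 * p.1 - 2 * p.2) := by positivity
  have h3 : 1 / (2 + p.1 + p.2) ≤ 2 * (1 / (3 + 2 * p.1 - 2 * p.2)) := by
    rw [mul_one_div, div_le_div_iff₀ k1 k3]; linarith
  simp only [T₀, eA, eB]
  constructor <;> linarith

lemma Tcomp_two_one_mono (m : ℕ) : ∀ t ∈ Ico (0 : ℝ) 1,
    (Tcomp t m (2, 1)).1 ≤ (Tcomp t (m + 1) (2, 1)).1 ∧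
      (Tcomp t (m + 1) (2, 1)).2 ≤ (Tcomp t m (2, 1)).2 := by
  induction m with
  | zero =>
    intro t ht
    rw [Tcomp_succ ht]
    rcases lt_or_ge t (1 / 2) with h | h
    · rw [T_digit_of_lt h]; simp [Tcomp, T₀_two_one]
    · rw [T_digit_of_ge h ht.2]; simp only [Tcomp, id, T₁_two_one]; norm_num
  | succ m ih =>
    intro t ht
    rw [Tcomp_succ ht, Tcomp_succ ht]
    have a := fun k => Tcomp_admissible one_pos le_rfl (S t) k admissible_two_one
    obtain ⟨i1, i2⟩ := ih (S t) (S_mem ht)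
    rcases lt_or_ge t (1 / 2) with h | h
    · rw [T_digit_of_lt h]; exact T₀_mono (a _) (a _) i1 i2
    · rw [T_digit_of_ge h ht.2]; exact T₁_mono (a _) (a _) i1 i2

lemma Tcomp_two_one_bounded : ∀ t ∈ Ico (0 : ℝ) 1, ∃ B, ∀ m, (Tcomp t m (2, 1)).1 ≤ B := by
  apply leadingOnes_induction
  · intro t h0 h
    refine ⟨35 / 12, fun m => ?_⟩
    rcases m with _ | m
    · norm_num [Tcomp]
    · rw [Tcomp_succ ⟨h0, by linarith⟩, T_digit_of_lt h]
      exact (T₀_bound (Tcomp_admissible one_pos le_rfl _ _ admissible_two_one)).1.le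
  · rintro t h h1 ⟨B, hB⟩
    refine ⟨max 2 (5 / 3 * B), fun m => ?_⟩
    rcases m with _ | m
    · simp [Tcomp]
    · rw [Tcomp_succ ⟨by linarith, h1⟩, T_digit_of_ge h h1]
      refine le_max_of_le_right ?_
      have ha := Tcomp_admissible one_pos le_rfl (S t) m admissible_two_one
      have hx : 0 < (Tcomp (S t) m (2, 1)).1 := by linarith [ha.1, ha.2]
      have : 0 ≤ (Tcomp (S t) m (2, 1)).2 ^ 2 / (2 * (Tcomp (S t) m (2, 1)).1) := by positivity
      simp only [T₁]
      linarith [hB m]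

/-- The limit of `T_{e_1(t)} ∘ ⋯ ∘ T_{e_m(t)} (2, 1)`, which turns out to be `(η₁ t, η₂ t)`. -/
noncomputable def etaLim (t : ℝ) : ℝ × ℝ := limUnder atTop fun m => Tcomp t m (2, 1)

lemma tendsto_etaLim {t : ℝ} (ht : t ∈ Ico (0 : ℝ) 1) :
    Tendsto (fun m => Tcomp t m (2, 1)) atTop (𝓝 (etaLim t)) := by
  obtain ⟨B, hB⟩ := Tcomp_two_one_bounded t ht
  have m1 : Monotone fun m => (Tcomp t m (2, 1)).1 :=
    monotone_nat_of_le_succ fun m => (Tcomp_two_one_mono m t ht).1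
  have m2 : Antitone fun m => (Tcomp t m (2, 1)).2 :=
    antitone_nat_of_succ_le fun m => (Tcomp_two_one_mono m t ht).2
  have t1 := tendsto_atTop_ciSup m1 ⟨B, by rintro _ ⟨m, rfl⟩; exact hB m⟩
  have t2 := tendsto_atTop_ciInf m2 ⟨0, by
    rintro _ ⟨m, rfl⟩; exact (Tcomp_admissible one_pos le_rfl t m admissible_two_one).1⟩
  exact tendsto_nhds_limUnder ⟨_, t1.prodMk_nhds t2⟩

lemma etaLim_admissible {t : ℝ} (ht : t ∈ Ico (0 : ℝ) 1) : Admissible 1 (etaLim t) := by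
  have a := fun m => Tcomp_admissible one_pos le_rfl t m admissible_two_one
  have h := tendsto_etaLim ht
  have h1 := (continuous_fst.tendsto _).comp h
  have h2 := (continuous_snd.tendsto _).comp h
  exact ⟨ge_of_tendsto' h2 fun m => (a m).1, ge_of_tendsto' (h1.sub h2) fun m => (a m).2⟩

lemma two_le_etaLim {t : ℝ} (ht : t ∈ Ico (0 : ℝ) 1) :
    2 ≤ (etaLim t).1 ∧ (etaLim t).2 ≤ 1 := by
  have h := tendsto_etaLim ht
  have h1 := (continuous_fst.tendsto _).comp h
  have h2 := (continuous_snd.tendsto _).comp h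
  have m1 : Monotone fun m => (Tcomp t m (2, 1)).1 :=
    monotone_nat_of_le_succ fun m => (Tcomp_two_one_mono m t ht).1
  have m2 : Antitone fun m => (Tcomp t m (2, 1)).2 :=
    antitone_nat_of_succ_le fun m => (Tcomp_two_one_mono m t ht).2
  exact ⟨ge_of_tendsto' h1 fun m => m1 (Nat.zero_le m),
    le_of_tendsto' h2 fun m => m2 (Nat.zero_le m)⟩

lemma continuousAt_T {d : ℝ} (hd : 0 < d) {p : ℝ × ℝ} (hp : Admissible d p) (e : Fin 2) :
    ContinuousAt (T e) p := by
  obtain ⟨h1, h2⟩ := hp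
  have k1 : 2 + p.1 + p.2 ≠ 0 := by linarith
  have k2 : 3 + 2 * p.1 - 2 * p.2 ≠ 0 := by linarith
  have k3 : 2 * p.1 ≠ 0 := by linarith
  have k4 : 6 * p.1 ≠ 0 := by linarith
  fin_cases e
  · simp only [Fin.zero_eta, T_zero]
    unfold T₀
    fun_prop (disch := assumption)
  · simp only [Fin.mk_one, T_one]
    unfold T₁
    fun_prop (disch := assumption)

lemma etaLim_eq {t : ℝ} (ht : t ∈ Ico (0 : ℝ) 1) :
    etaLim t = T (digit t 0) (etaLim (S t)) := by
  have h := (tendsto_add_atTop_iff_nat 1).2 (tendsto_etaLim ht)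
  simp only [Tcomp_succ ht] at h
  have hS := S_mem ht
  exact tendsto_nhds_unique h
    ((continuousAt_T one_pos (etaLim_admissible hS) _).tendsto.comp (tendsto_etaLim hS))

lemma etaLim_of_lt {t : ℝ} (h0 : 0 ≤ t) (h : t < 1 / 2) : etaLim t = T₀ (etaLim (S t)) := by
  rw [etaLim_eq ⟨h0, by linarith⟩, T_digit_of_lt h]

lemma etaLim_of_ge {t : ℝ} (h : 1 / 2 ≤ t) (h1 : t < 1) : etaLim t = T₁ (etaLim (S t)) := by
  rw [etaLim_eq ⟨by linarith, h1⟩, T_digit_of_ge h h1]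

lemma etaLim_eq_Tcomp {t : ℝ} (ht : t ∈ Ico (0 : ℝ) 1) (m : ℕ) :
    ∃ s ∈ Ico (0 : ℝ) 1, etaLim t = Tcomp t m (etaLim s) := by
  induction m generalizing t with
  | zero => exact ⟨t, ht, rfl⟩
  | succ m ih =>
    obtain ⟨s, hs, h⟩ := ih (S_mem ht)
    exact ⟨s, hs, by rw [Tcomp_succ ht, ← h, etaLim_eq ht]⟩

/-- `η` is strictly monotone: follow the common digits until the first different one, where
`T₀_bound` separates the values. -/
lemma etaLim_strictMono {t t' : ℝ} (ht : t ∈ Ico (0 : ℝ) 1) (ht' : t' ∈ Ico (0 : ℝ) 1)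
    (h : t < t') : (etaLim t).1 < (etaLim t').1 ∧ (etaLim t').2 < (etaLim t).2 := by
  have key : ∀ n : ℕ, ∀ t ∈ Ico (0 : ℝ) 1, ∀ t' ∈ Ico (0 : ℝ) 1, (1 / 2) ^ n < t' - t →
      (etaLim t).1 < (etaLim t').1 ∧ (etaLim t').2 < (etaLim t).2 := by
    intro n
    induction n with
    | zero => intro t ht t' ht' h; norm_num at h; linarith [ht.1, ht'.2]
    | succ n ih =>
      intro t ht t' ht' h
      have hp : (0 : ℝ) < (1 / 2) ^ n := by positivity
      rw [pow_succ] at h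
      have hS := S_mem ht
      have hS' := S_mem ht'
      have hA := etaLim_admissible hS
      have hA' := etaLim_admissible hS'
      rcases lt_or_ge t' (1 / 2) with h2 | h2
      · have h1 : t < 1 / 2 := by linarith
        obtain ⟨i1, i2⟩ := ih _ hS _ hS' (by rw [S_of_lt ht.1 h1, S_of_lt ht'.1 h2]; linarith)
        rw [etaLim_of_lt ht.1 h1, etaLim_of_lt ht'.1 h2]
        exact T₀_strictMono hA hA' i1 i2
      rcases lt_or_ge t (1 / 2) with h1 | h1
      · rw [etaLim_of_lt ht.1 h1, etaLim_of_ge h2 ht'.2]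
        obtain ⟨i1, i2⟩ := two_le_etaLim hS'
        have := T₁_mono admissible_two_one hA' i1 i2
        rw [T₁_two_one] at this
        have hb := T₀_bound hA
        exact ⟨hb.1.trans_le this.1, this.2.trans_lt hb.2⟩
      · obtain ⟨i1, i2⟩ := ih _ hS _ hS' (by rw [S_of_ge h1 ht.2, S_of_ge h2 ht'.2]; linarith)
        rw [etaLim_of_ge h1 ht.2, etaLim_of_ge h2 ht'.2]
        exact T₁_strictMono hA hA' i1 i2
  obtain ⟨n, hn⟩ := exists_pow_lt_of_lt_one (sub_pos.2 h) (by norm_num : (1 / 2 : ℝ) < 1)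
  exact key n t ht t' ht' hn

/-! ### Contraction -/

/-- The sums `x + y`, and the differences `x - y`, of the two points have ratio at most `1 + ε`:
closeness in the Thompson part metric, in the coordinates `x + y`, `x - y` that `T₀` decouples. -/
def RatioClose (ε : ℝ) (p p' : ℝ × ℝ) : Prop :=
  (p.1 + p.2 ≤ (1 + ε) * (p'.1 + p'.2) ∧ p.1 - p.2 ≤ (1 + ε) * (p'.1 - p'.2)) ∧
    (p'.1 + p'.2 ≤ (1 + ε) * (p.1 + p.2) ∧ p'.1 - p'.2 ≤ (1 + ε) * (p.1 - p.2))

lemma RatioClose.mono {d ε ε' : ℝ} {p p' : ℝ × ℝ} (hd : 0 < d) (hp : Admissible d p)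
    (hp' : Admissible d p') (h : RatioClose ε p p') (hε : ε ≤ ε') : RatioClose ε' p p' := by
  obtain ⟨a1, a2⟩ := hp
  obtain ⟨b1, b2⟩ := hp'
  obtain ⟨⟨h1, h2⟩, h3, h4⟩ := h
  exact ⟨⟨h1.trans (by gcongr; linarith), h2.trans (by gcongr; linarith)⟩,
    h3.trans (by gcongr; linarith), h4.trans (by gcongr; linarith)⟩

/-- One half of the contraction property of `T₀`, for the sums. -/
lemma sum_contraction {ε κ s s' : ℝ} (hε : 0 ≤ ε) (hκ : 1 / 2 ≤ κ) (hs : 0 < s) (hs' : 0 < s')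
    (h : s ≤ (1 + ε) * s') : (3 + 2 * s) / (2 + s) ≤ (1 + κ * ε) * ((3 + 2 * s') / (2 + s')) := by
  have h1 : (3 + 2 * s) / (2 + s) ≤ (3 + 2 * ((1 + ε) * s')) / (2 + (1 + ε) * s') := by
    rw [div_le_div_iff₀ (by positivity) (by positivity)]
    nlinarith
  refine h1.trans ?_
  rw [← mul_div_assoc, div_le_div_iff₀ (by positivity) (by positivity)]
  have e : (1 + κ * ε) * (3 + 2 * s') * (2 + (1 + ε) * s') - (3 + 2 * ((1 + ε) * s')) * (2 + s')
      = ε * (κ * (6 + 7 * s' + 2 * s' ^ 2 + ε * s' * (3 + 2 * s')) - s') := by ring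
  have e2 : s' ≤ κ * (6 + 7 * s' + 2 * s' ^ 2 + ε * s' * (3 + 2 * s')) := by
    have : 0 ≤ ε * s' * (3 + 2 * s') := by positivity
    nlinarith [sq_nonneg s']
  have e3 := mul_nonneg hε (sub_nonneg.2 e2)
  linarith

/-- One half of the contraction property of `T₀`, for the differences. -/
lemma diff_contraction {ε κ d s s' : ℝ} (hε : 0 ≤ ε) (hd : 0 < d) (hκ : κ = 3 / (3 + 2 * d))
    (hs : d ≤ s) (hs' : d ≤ s') (h : s ≤ (1 + ε) * s') :
    s / (3 + 2 * s) ≤ (1 + κ * ε) * (s' / (3 + 2 * s')) := by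
  have hs0 : 0 < s := hd.trans_le hs
  have hs0' : 0 < s' := hd.trans_le hs'
  have h1 : s / (3 + 2 * s) ≤ ((1 + ε) * s') / (3 + 2 * ((1 + ε) * s')) := by
    rw [div_le_div_iff₀ (by positivity) (by positivity)]
    nlinarith
  refine h1.trans ?_
  have hκ0 : 0 < κ := by rw [hκ]; positivity
  have hκ1 : 3 ≤ κ * (3 + 2 * s') := by
    have : κ * (3 + 2 * d) = 3 := by rw [hκ]; field_simp
    nlinarith
  rw [← mul_div_assoc, div_le_div_iff₀ (by positivity) (by positivity)]
  have e : (1 + κ * ε) * s' * (3 + 2 * ((1 + ε) * s')) - (1 + ε) * s' * (3 + 2 * s')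
      = s' * ε * ((κ * (3 + 2 * s') - 3) + 2 * κ * ε * s') := by ring
  have e2 : 0 ≤ s' * ε * ((κ * (3 + 2 * s') - 3) + 2 * κ * ε * s') := by
    have : 0 ≤ κ * (3 + 2 * s') - 3 := by linarith
    positivity
  linarith

lemma RatioClose.T₀ {ε d : ℝ} (hε : 0 ≤ ε) (hd : 0 < d) (hd1 : d ≤ 1) {p p' : ℝ × ℝ}
    (hp : Admissible d p) (hp' : Admissible d p') (h : RatioClose ε p p') :
    RatioClose (3 / (3 + 2 * d) * ε) (T₀ p) (T₀ p') := by
  obtain ⟨a1, a2⟩ := hp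
  obtain ⟨b1, b2⟩ := hp'
  obtain ⟨⟨h1, h2⟩, h3, h4⟩ := h
  have hκ : 1 / 2 ≤ 3 / (3 + 2 * d) := by
    rw [div_le_div_iff₀ (by norm_num) (by positivity)]; linarith
  have g1 := sum_contraction hε hκ (by linarith) (by linarith) h1
  have g2 := diff_contraction hε hd rfl a2 b2 h2
  have g3 := sum_contraction hε hκ (by linarith) (by linarith) h3
  have g4 := diff_contraction hε hd rfl b2 a2 h4
  rw [RatioClose, T₀_add, T₀_sub, T₀_add, T₀_sub]
  refine ⟨⟨?_, ?_⟩, ?_, ?_⟩ <;> linarith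

/-- The harmonic mean is increasing and homogeneous. -/
lemma harmonicMean_le {c s d s' d' : ℝ} (hc : 0 < c) (hs : 0 < s) (hd : 0 < d) (hs' : 0 < s')
    (hd' : 0 < d') (h1 : s ≤ c * s') (h2 : d ≤ c * d') :
    s * d / (s + d) ≤ c * (s' * d' / (s' + d')) := by
  have e1 : s * d / (s + d) = 1 / (1 / s + 1 / d) := by field_simp; ring
  have e2 : c * (s' * d' / (s' + d')) = 1 / (1 / (c * s') + 1 / (c * d')) := by field_simp; ring
  rw [e1, e2]
  gcongr

lemma RatioClose.T₁ {ε d : ℝ} (hε : 0 ≤ ε) (hd : 0 < d) {p p' : ℝ × ℝ}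
    (hp : Admissible d p) (hp' : Admissible d p') (h : RatioClose ε p p') :
    RatioClose ε (T₁ p) (T₁ p') := by
  obtain ⟨a1, a2⟩ := hp
  obtain ⟨b1, b2⟩ := hp'
  obtain ⟨⟨h1, h2⟩, h3, h4⟩ := h
  have g2 := harmonicMean_le (by linarith : 0 < 1 + ε) (by linarith) (by linarith) (by linarith)
    (by linarith) h1 h2
  have g4 := harmonicMean_le (by linarith : 0 < 1 + ε) (by linarith) (by linarith) (by linarith)
    (by linarith) h3 h4
  rw [RatioClose, T₁_add, T₁_sub (by linarith), T₁_add, T₁_sub (by linarith)]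
  refine ⟨⟨?_, ?_⟩, ?_, ?_⟩ <;> linarith

/-- `T₀` maps the unbounded admissible region to a set of bounded ratios. -/
lemma ratioClose_T₀ {d : ℝ} (hd : 0 < d) (hd1 : d ≤ 1) {p p' : ℝ × ℝ}
    (hp : Admissible d p) (hp' : Admissible d p') : RatioClose (5 / (2 * d)) (T₀ p) (T₀ p') := by
  have bounds : ∀ p, Admissible d p → (5 / 2 ≤ (T₀ p).1 + (T₀ p).2 ∧
      (T₀ p).1 + (T₀ p).2 ≤ 10 / 3) ∧ d ≤ (T₀ p).1 - (T₀ p).2 ∧ (T₀ p).1 - (T₀ p).2 ≤ 5 / 2 := by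
    intro p hp
    refine ⟨?_, (T₀_admissible hd hd1 hp).2, ?_⟩
    · obtain ⟨a1, a2⟩ := hp
      rw [T₀_add, ← mul_div_assoc, le_div_iff₀ (by linarith), div_le_iff₀ (by linarith)]
      constructor <;> linarith
    · obtain ⟨a1, a2⟩ := hp
      rw [T₀_sub, ← mul_div_assoc, div_le_iff₀ (by linarith)]
      linarith
  have hε : 5 / 2 = 5 / (2 * d) * d := by field_simp
  have hε1 : 5 / 2 ≤ 5 / (2 * d) := by
    rw [div_le_div_iff₀ (by norm_num) (by positivity)]; linarith
  have key : ∀ s s' u u' : ℝ, 5 / 2 ≤ s' → s ≤ 10 / 3 → d ≤ u' → u ≤ 5 / 2 →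
      s ≤ (1 + 5 / (2 * d)) * s' ∧ u ≤ (1 + 5 / (2 * d)) * u' := by
    intro s s' u u' h1 h2 h3 h4
    constructor <;> nlinarith
  obtain ⟨⟨a1, a2⟩, a3, a4⟩ := bounds p hp
  obtain ⟨⟨b1, b2⟩, b3, b4⟩ := bounds p' hp'
  exact ⟨key _ _ _ _ b1 a2 b3 a4, key _ _ _ _ a1 b2 a3 b4⟩

lemma Tcomp_ratioClose {d : ℝ} (hd : 0 < d) (hd1 : d ≤ 1) {p p' : ℝ × ℝ}
    (hp : Admissible d p) (hp' : Admissible d p') (m : ℕ) : ∀ k, ∀ t ∈ Ico (0 : ℝ) 1,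
    k + 1 ≤ zeroCount t m →
      RatioClose ((3 / (3 + 2 * d)) ^ k * (5 / (2 * d))) (Tcomp t m p) (Tcomp t m p') := by
  induction m with
  | zero => intro k t _ h; simp [zeroCount] at h
  | succ m ih =>
    intro k t ht h
    have a := fun s => Tcomp_admissible hd hd1 s m hp
    have a' := fun s => Tcomp_admissible hd hd1 s m hp'
    rw [Tcomp_succ ht, Tcomp_succ ht]
    rcases lt_or_ge t (1 / 2) with h2 | h2
    · rw [T_digit_of_lt h2]
      rcases k with _ | k
      · simpa using ratioClose_T₀ hd hd1 (a _) (a' _)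
      · simp only [zeroCount, h2, if_true] at h
        have := (ih k (S t) (S_mem ht) (by omega)).T₀ (by positivity) hd hd1 (a _) (a' _)
        rwa [← mul_assoc, ← pow_succ'] at this
    · rw [T_digit_of_ge h2 ht.2]
      simp only [zeroCount, not_lt.2 h2, if_false, zero_add] at h
      exact (ih k (S t) (S_mem ht) h).T₁ (by positivity) hd (a _) (a' _)

lemma exists_contraction_lt {d ε : ℝ} (hd : 0 < d) (hε : 0 < ε) :
    ∃ k : ℕ, (3 / (3 + 2 * d)) ^ k * (5 / (2 * d)) < ε := by
  have h1 : 3 / (3 + 2 * d) < 1 := by rw [div_lt_one (by positivity)]; linarith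
  obtain ⟨k, hk⟩ := exists_pow_lt_of_lt_one (show 0 < ε / (5 / (2 * d)) by positivity) h1
  exact ⟨k, by rwa [lt_div_iff₀ (by positivity)] at hk⟩

lemma tendsto_of_mul_bounds {ι : Type*} {l : Filter ι} {f : ι → ℝ} {a : ℝ} (ha : 0 < a)
    (h : ∀ ε > 0, ∀ᶠ i in l, f i ≤ (1 + ε) * a ∧ a ≤ (1 + ε) * f i) : Tendsto f l (𝓝 a) := by
  rw [Metric.tendsto_nhds]
  intro r hr
  filter_upwards [h (r / (2 * (a + r))) (by positivity)] with i hi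
  obtain ⟨h1, h2⟩ := hi
  have e : r / (2 * (a + r)) * (a + r) = r / 2 := by field_simp
  have e0 : 0 < r / (2 * (a + r)) := by positivity
  have hf : f i < a + r := by nlinarith
  rw [Real.dist_eq, abs_lt]
  constructor <;> nlinarith

lemma tendsto_of_ratioClose {ι : Type*} {l : Filter ι} {f : ι → ℝ × ℝ} {p : ℝ × ℝ}
    {d : ℝ} (hd : 0 < d) (hp : Admissible d p)
    (h : ∀ ε > 0, ∀ᶠ i in l, RatioClose ε (f i) p) : Tendsto f l (𝓝 p) := by
  obtain ⟨h1, h2⟩ := hp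
  have hs : Tendsto (fun i => (f i).1 + (f i).2) l (𝓝 (p.1 + p.2)) :=
    tendsto_of_mul_bounds (by linarith) fun ε hε => (h ε hε).mono fun i hi => ⟨hi.1.1, hi.2.1⟩
  have hδ : Tendsto (fun i => (f i).1 - (f i).2) l (𝓝 (p.1 - p.2)) :=
    tendsto_of_mul_bounds (by linarith) fun ε hε => (h ε hε).mono fun i hi => ⟨hi.1.2, hi.2.2⟩
  have e1 := ((hs.add hδ).div_const 2).prodMk_nhds ((hs.sub hδ).div_const 2)
  convert e1 using 2
  · ext <;> simp
  · ext <;> simp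

lemma tendsto_Tcomp {t : ℝ} (ht : t ∈ Ico (0 : ℝ) 1) {c : ℝ × ℝ} (h2 : 0 ≤ c.2)
    (h1 : c.2 < c.1) : Tendsto (fun m => Tcomp t m c) atTop (𝓝 (etaLim t)) := by
  set d := min 1 (c.1 - c.2) with hd'
  have hd : 0 < d := lt_min one_pos (by linarith)
  have hd1 : d ≤ 1 := min_le_left _ _
  have hc : Admissible d c := ⟨h2, min_le_right _ _⟩
  refine tendsto_of_ratioClose one_pos (etaLim_admissible ht) fun ε hε => ?_
  obtain ⟨k, hk⟩ := exists_contraction_lt hd hε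
  obtain ⟨m₀, hm₀⟩ := zeroCount_unbounded (k + 1) t ht
  filter_upwards [eventually_ge_atTop m₀] with m hm
  obtain ⟨s, hs, e⟩ := etaLim_eq_Tcomp ht m
  have hs' := (etaLim_admissible hs).mono hd1
  rw [e]
  exact (Tcomp_ratioClose hd hd1 hc hs' m k t ht (hm₀.trans (zeroCount_mono t hm))).mono hd
    (Tcomp_admissible hd hd1 _ _ hc) (Tcomp_admissible hd hd1 _ _ hs') hk.le

/-! ### Continuity of the limit -/

lemma etaLim_blowup (n : ℕ) : ∀ t ∈ Ico (0 : ℝ) 1, 1 - (1 / 2) ^ n ≤ t →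
    Admissible ((5 / 3) ^ n) (etaLim t) := by
  induction n with
  | zero => intro t ht _; simpa using etaLim_admissible ht
  | succ n ih =>
    intro t ht h
    have hp : ((1 : ℝ) / 2) ^ n ≤ 1 := pow_le_one₀ (by norm_num) (by norm_num)
    rw [pow_succ] at h
    have h2 : 1 / 2 ≤ t := by linarith
    rw [etaLim_of_ge h2 ht.2, pow_succ']
    exact T₁_admissible (by positivity) (ih _ (S_mem ht) (by rw [S_of_ge h2 ht.2]; linarith))

/-- As `p → ∞` with `p` admissible, `T₀ p → T₁ (2, 1)`; this makes `η` left continuous at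
dyadic points. -/
lemma T₀_ratioClose_of_large {L : ℝ} (hL : 1 ≤ L) {p : ℝ × ℝ} (hp : Admissible L p) :
    RatioClose (2 / L) (T₀ p) (T₁ (2, 1)) := by
  obtain ⟨h1, h2⟩ := hp
  have hL0 : 0 < L := by linarith
  have e : 2 / L * L = 2 := by field_simp
  have e0 : 0 < 2 / L := by positivity
  have hs : (0 : ℝ) < 2 + (p.1 + p.2) := by linarith
  have hd : (0 : ℝ) < 3 + 2 * (p.1 - p.2) := by linarith
  have a1 : 2 ≤ 2 / L * (p.1 + p.2) := by
    refine e.symm.le.trans (mul_le_mul_of_nonneg_left (by linarith) e0.le)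
  have a2 : 2 ≤ 2 / L * (p.1 - p.2) := by
    refine e.symm.le.trans (mul_le_mul_of_nonneg_left (by linarith) e0.le)
  rw [RatioClose, T₀_add, T₀_sub, T₁_two_one]
  refine ⟨⟨?_, ?_⟩, ?_, ?_⟩
  · have : (3 + 2 * (p.1 + p.2)) / (2 + (p.1 + p.2)) ≤ 2 := by
      rw [div_le_iff₀ hs]; linarith
    norm_num
    linarith
  · have : (p.1 - p.2) / (3 + 2 * (p.1 - p.2)) ≤ 1 / 2 := by
      rw [div_le_iff₀ hd]; linarith
    norm_num
    linarith
  · rw [← mul_div_assoc, ← mul_div_assoc, le_div_iff₀ hs]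
    norm_num
    nlinarith
  · rw [← mul_div_assoc, ← mul_div_assoc, le_div_iff₀ hd]
    norm_num
    nlinarith

lemma S_zero : S 0 = 0 := by rw [S_of_lt le_rfl (by norm_num)]; norm_num

lemma etaLim_zero : etaLim 0 = (2, 1) := by
  have h : ∀ m, Tcomp 0 m (2, 1) = (2, 1) := by
    intro m
    induction m with
    | zero => rfl
    | succ m ih =>
      rw [Tcomp_succ ⟨le_rfl, one_pos⟩, S_zero, ih, T_digit_of_lt (by norm_num), T₀_two_one]
  have := tendsto_etaLim (t := 0) ⟨le_rfl, one_pos⟩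
  simp only [h] at this
  exact tendsto_nhds_unique this tendsto_const_nhds

lemma etaLim_ratioClose (k : ℕ) : ∀ t ∈ Ico (0 : ℝ) 1, ∃ r > 0, ∀ s ∈ Ico (0 : ℝ) 1,
    |s - t| < r →
      RatioClose ((3 / (3 + 2 * 1)) ^ k * (5 / (2 * 1))) (etaLim s) (etaLim t) := by
  -- a digit `1` preserves the estimate for `S t`; this is common to both steps of the induction
  have ones : ∀ k : ℕ, ∀ t, 1 / 2 ≤ t → t < 1 →
      (∃ r > 0, ∀ s ∈ Ico (0 : ℝ) 1, |s - S t| < r →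
        RatioClose ((3 / (3 + 2 * 1)) ^ k * (5 / (2 * 1))) (etaLim s) (etaLim (S t))) →
      ∃ r > 0, ∀ s ∈ Ico (0 : ℝ) 1, |s - t| < r →
        RatioClose ((3 / (3 + 2 * 1)) ^ k * (5 / (2 * 1))) (etaLim s) (etaLim t) := by
    rintro k t h h1 ⟨r, hr, H⟩
    have right : ∀ s ∈ Ico (0 : ℝ) 1, |s - t| < r / 2 → 1 / 2 ≤ s →
        RatioClose ((3 / (3 + 2 * 1)) ^ k * (5 / (2 * 1))) (etaLim s) (etaLim t) := by
      intro s hs hst h2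
      rw [etaLim_of_ge h h1, etaLim_of_ge h2 hs.2]
      have hd : |S s - S t| < r := by
        rw [S_of_ge h h1, S_of_ge h2 hs.2, show 2 * s - 1 - (2 * t - 1) = 2 * (s - t) by ring,
          abs_mul, abs_two]
        linarith
      exact (H _ (S_mem hs) hd).T₁ (by positivity) one_pos (etaLim_admissible (S_mem hs))
        (etaLim_admissible (S_mem ⟨by linarith, h1⟩))
    rcases h.lt_or_eq with h' | rfl
    · refine ⟨min (r / 2) (t - 1 / 2), lt_min (by linarith) (by linarith), fun s hs hst => ?_⟩
      refine right s hs (hst.trans_le (min_le_left _ _)) ?_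
      have := (abs_lt.1 (hst.trans_le (min_le_right _ _))).1
      linarith
    · -- to the left of `1/2` the digits are `0` followed by a long run of `1`
      set ε : ℝ := (3 / (3 + 2 * 1)) ^ k * (5 / (2 * 1)) with hε
      have hε0 : 0 < ε := by positivity
      obtain ⟨n, hn⟩ := pow_unbounded_of_one_lt (2 / ε) (by norm_num : (1 : ℝ) < 5 / 3)
      refine ⟨min (r / 2) ((1 / 2) ^ (n + 1)), lt_min (by linarith) (by positivity),
        fun s hs hst => ?_⟩
      rcases lt_or_ge s (1 / 2) with h2 | h2
      · have h3 := (abs_lt.1 (hst.trans_le (min_le_right _ _))).1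
        rw [pow_succ] at h3
        have hb := etaLim_blowup n _ (S_mem hs) (by rw [S_of_lt hs.1 h2]; linarith)
        have e : etaLim (1 / 2) = T₁ (2, 1) := by
          rw [etaLim_of_ge le_rfl (by norm_num), S_of_ge le_rfl (by norm_num)]
          norm_num [etaLim_zero]
        have hle : (1 : ℝ) ≤ (5 / 3) ^ n := one_le_pow₀ (by norm_num)
        rw [etaLim_of_lt hs.1 h2, e]
        refine (T₀_ratioClose_of_large hle hb).mono one_pos
          (T₀_admissible one_pos le_rfl (hb.mono hle))
          ((T₁_admissible one_pos admissible_two_one).mono (by norm_num)) ?_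
        rw [div_lt_iff₀ hε0] at hn
        rw [div_le_iff₀ (by positivity)]
        linarith
      · exact right s hs (hst.trans_le (min_le_left _ _)) h2
  induction k with
  | zero =>
    refine leadingOnes_induction (fun t h0 h => ?_) (ones 0)
    refine ⟨1 / 2 - t, by linarith, fun s hs hst => ?_⟩
    have h2 : s < 1 / 2 := by linarith [(abs_lt.1 hst).2]
    rw [etaLim_of_lt h0 h, etaLim_of_lt hs.1 h2, pow_zero, one_mul]
    exact ratioClose_T₀ one_pos le_rfl (etaLim_admissible (S_mem hs))
      (etaLim_admissible (S_mem ⟨h0, by linarith⟩))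
  | succ k ih =>
    refine leadingOnes_induction (fun t h0 h => ?_) (ones (k + 1))
    have ht : t ∈ Ico (0 : ℝ) 1 := ⟨h0, by linarith⟩
    obtain ⟨r, hr, H⟩ := ih _ (S_mem ht)
    refine ⟨min (r / 2) (1 / 2 - t), lt_min (by linarith) (by linarith), fun s hs hst => ?_⟩
    have h2 : s < 1 / 2 := by linarith [(abs_lt.1 (hst.trans_le (min_le_right _ _))).2]
    have hd : |S s - S t| < r := by
      rw [S_of_lt h0 h, S_of_lt hs.1 h2, ← mul_sub, abs_mul, abs_two]
      linarith [hst.trans_le (min_le_left _ _)]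
    rw [etaLim_of_lt h0 h, etaLim_of_lt hs.1 h2, pow_succ', mul_assoc]
    exact (H _ (S_mem hs) hd).T₀ (by positivity) one_pos le_rfl (etaLim_admissible (S_mem hs))
      (etaLim_admissible (S_mem ht))

lemma continuousOn_etaLim : ContinuousOn etaLim (Ico 0 1) := by
  intro t ht
  refine tendsto_of_ratioClose one_pos (etaLim_admissible ht) fun ε hε => ?_
  obtain ⟨k, hk⟩ := exists_contraction_lt one_pos hε
  obtain ⟨r, hr, H⟩ := etaLim_ratioClose k t ht
  filter_upwards [self_mem_nhdsWithin,
    mem_nhdsWithin_of_mem_nhds (Metric.ball_mem_nhds t hr)] with s hs hst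
  exact (H s hs (by rwa [Metric.mem_ball, Real.dist_eq] at hst)).mono one_pos
    (etaLim_admissible hs) (etaLim_admissible ht) hk.le

/-! ### Barycentric coordinates and the cells of the gasket -/

/-- The barycentric coordinates with respect to the triangle `q₀ q₁ q₂`. -/
noncomputable def bary (i : Fin 3) (z : ℝ × ℝ) : ℝ :=
  ![z.2, 1 - z.2 / 2 - Real.sqrt 3 / 2 * z.1, (Real.sqrt 3 * z.1 - z.2) / 2] i

lemma bary_zero (z : ℝ × ℝ) : bary 0 z = z.2 := rfl

lemma bary_q (i j : Fin 3) : bary i (q j) = if i = j then 1 else 0 := by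
  have h : Real.sqrt 3 ≠ 0 := by positivity
  fin_cases i <;> fin_cases j <;> simp [bary, q] <;> field_simp
  all_goals norm_num

lemma bary_F (i j : Fin 3) (z : ℝ × ℝ) :
    bary i (F j z) = (bary i z + if i = j then 1 else 0) / 2 := by
  have h : Real.sqrt 3 ≠ 0 := by positivity
  fin_cases i <;> fin_cases j <;> simp [bary, q, F] <;> field_simp <;> ring

lemma bary_sum (z : ℝ × ℝ) : bary 0 z + bary 1 z + bary 2 z = 1 := by
  simp [bary]; ring

lemma bary_ext {z z' : ℝ × ℝ} (h : ∀ i, bary i z = bary i z') : z = z' := by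
  have h3 : Real.sqrt 3 ≠ 0 := by positivity
  have h0 := h 0
  have h2 := h 2
  simp only [bary, Matrix.cons_val] at h0 h2
  have h1 : Real.sqrt 3 * z.1 = Real.sqrt 3 * z'.1 := by linarith
  exact Prod.ext (mul_left_cancel₀ h3 h1) h0

lemma continuous_bary (i : Fin 3) : Continuous (bary i) := by
  fin_cases i <;> unfold bary <;> simp <;> fun_prop

/-- The inverse of `F i`. -/
noncomputable def Finv (i : Fin 3) (z : ℝ × ℝ) : ℝ × ℝ := (2 : ℝ) • z - q i

lemma Finv_F (i : Fin 3) (z : ℝ × ℝ) : Finv i (F i z) = z := by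
  simp [Finv, F, smul_smul]

lemma F_Finv (i : Fin 3) (z : ℝ × ℝ) : F i (Finv i z) = z := by
  simp [Finv, F, smul_sub, smul_smul]

lemma continuous_F (i : Fin 3) : Continuous (F i) := by unfold F; fun_prop

lemma continuous_Finv (i : Fin 3) : Continuous (Finv i) := by unfold Finv; fun_prop

lemma F_q_self (i : Fin 3) : F i (q i) = q i := by
  rw [F, ← add_smul]; norm_num

lemma F_q_comm (i j : Fin 3) : F i (q j) = F j (q i) := by
  simp only [F]; abel

lemma F_snd (i : Fin 3) (z : ℝ × ℝ) : (F i z).2 = (z.2 + if i = 0 then 1 else 0) / 2 := by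
  have := bary_F 0 i z
  simp only [bary_zero, eq_comm (a := (0 : Fin 3))] at this
  exact this

lemma dist_F (i : Fin 3) (z z' : ℝ × ℝ) : dist (F i z) (F i z') = dist z z' / 2 := by
  rw [F, F, dist_add_right, dist_smul₀]
  norm_num
  ring

lemma q_mem_V (m : ℕ) (i : Fin 3) : q i ∈ V m := by
  induction m with
  | zero => exact ⟨i, rfl⟩
  | succ m ih => exact mem_iUnion.2 ⟨i, q i, ih, F_q_self i⟩

lemma F_mem_V {m : ℕ} {z : ℝ × ℝ} (hz : z ∈ V m) (i : Fin 3) : F i z ∈ V (m + 1) :=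
  mem_iUnion.2 ⟨i, z, hz, rfl⟩

lemma V_mono : Monotone V := by
  refine monotone_nat_of_le_succ fun m => ?_
  induction m with
  | zero => rintro _ ⟨i, rfl⟩; exact q_mem_V 1 i
  | succ m ih => exact iUnion_mono fun i => image_mono ih

lemma V_finite (m : ℕ) : (V m).Finite := by
  induction m with
  | zero => exact finite_range q
  | succ m ih => exact finite_iUnion fun i => ih.image _

lemma V_subset_SG (m : ℕ) : V m ⊆ SG := (subset_iUnion V m).trans subset_closure

lemma q_mem_SG (i : Fin 3) : q i ∈ SG := V_subset_SG 0 ⟨i, rfl⟩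

lemma F_mem_SG {z : ℝ × ℝ} (hz : z ∈ SG) (i : Fin 3) : F i z ∈ SG := by
  refine map_mem_closure (continuous_F i) hz fun x hx => ?_
  obtain ⟨m, hm⟩ := mem_iUnion.1 hx
  exact mem_iUnion.2 ⟨m + 1, F_mem_V hm i⟩

lemma bary_nonneg_of_mem_SG {z : ℝ × ℝ} (hz : z ∈ SG) (i : Fin 3) : 0 ≤ bary i z := by
  have key : ∀ m, ∀ z ∈ V m, ∀ i, 0 ≤ bary i z := by
    intro m
    induction m with
    | zero => rintro _ ⟨j, rfl⟩ i; rw [bary_q]; split_ifs <;> norm_num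
    | succ m ih =>
      intro z hz i
      obtain ⟨j, z', hz', rfl⟩ := mem_iUnion.1 hz
      have := ih z' hz' i
      rw [bary_F]; split_ifs <;> linarith
  have hc : IsClosed {z | 0 ≤ bary i z} := isClosed_le continuous_const (continuous_bary i)
  refine closure_minimal ?_ hc hz
  intro x hx
  obtain ⟨m, hm⟩ := mem_iUnion.1 hx
  exact key m x hm i

lemma bary_le_one_of_mem_SG {z : ℝ × ℝ} (hz : z ∈ SG) (i : Fin 3) : bary i z ≤ 1 := by
  have h := bary_sum z
  have h0 := bary_nonneg_of_mem_SG hz 0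
  have h1 := bary_nonneg_of_mem_SG hz 1
  have h2 := bary_nonneg_of_mem_SG hz 2
  fin_cases i <;> simp only [Fin.zero_eta, Fin.mk_one, Fin.reduceFinMk] <;> linarith

lemma eq_q_of_bary {z : ℝ × ℝ} (hz : z ∈ SG) {i : Fin 3} (h : 1 ≤ bary i z) : z = q i := by
  have hs := bary_sum z
  have h0 := bary_nonneg_of_mem_SG hz 0
  have h1 := bary_nonneg_of_mem_SG hz 1
  have h2 := bary_nonneg_of_mem_SG hz 2
  apply bary_ext
  intro j
  rw [bary_q]
  fin_cases i <;> fin_cases j <;>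
    simp only [Fin.zero_eta, Fin.mk_one, Fin.reduceFinMk] at h ⊢ <;>
    first | (rw [if_pos trivial]; linarith) | (rw [if_neg (by decide)]; linarith)

lemma isCompact_SG : IsCompact SG := by
  refine Metric.isCompact_of_isClosed_isBounded isClosed_closure ?_
  refine (Metric.isBounded_Icc ((0 : ℝ), (0 : ℝ)) (2, 1)).subset fun z hz => ?_
  have h3 : 1 ≤ Real.sqrt 3 := Real.one_le_sqrt.2 (by norm_num)
  have hs := bary_sum z
  have h0 := bary_nonneg_of_mem_SG hz 0
  have h1 := bary_nonneg_of_mem_SG hz 1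
  have h2 := bary_nonneg_of_mem_SG hz 2
  simp only [bary, Matrix.cons_val] at h0 h1 h2
  have hx : 0 ≤ z.1 := by
    by_contra h
    have : Real.sqrt 3 * z.1 < 0 := mul_neg_of_pos_of_neg (by linarith) (not_le.1 h)
    linarith
  exact ⟨⟨hx, h0⟩, by simp only; nlinarith, by simp only; nlinarith⟩

lemma SG_eq_iUnion : SG = ⋃ i, F i '' SG := by
  apply Subset.antisymm
  · refine closure_minimal (iUnion_subset fun m => (V_mono (Nat.le_succ m)).trans ?_)
      (isClosed_iUnion_of_finite fun i => (isCompact_SG.image (continuous_F i)).isClosed)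
    exact iUnion_mono fun i => image_mono (V_subset_SG m)
  · exact iUnion_subset fun i => image_subset_iff.2 fun z hz => F_mem_SG hz i

lemma exists_F_of_mem_SG {z : ℝ × ℝ} (hz : z ∈ SG) : ∃ i, ∃ z' ∈ SG, F i z' = z := by
  rw [SG_eq_iUnion] at hz
  simpa using hz

/-- The function on the gasket that equals `f i ∘ F_i⁻¹` on the cell `F_i SG`. Off the gasket its
values are irrelevant. -/
noncomputable def glue (f : Fin 3 → ℝ × ℝ → ℝ) (z : ℝ × ℝ) : ℝ :=
  if 1 / 2 ≤ bary 0 z then f 0 (Finv 0 z) else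
    if 1 / 2 ≤ bary 1 z then f 1 (Finv 1 z) else f 2 (Finv 2 z)

lemma glue_F {f : Fin 3 → ℝ × ℝ → ℝ} (hf : ∀ i j, f i (q j) = f j (q i)) (i : Fin 3)
    {z : ℝ × ℝ} (hz : z ∈ SG) : glue f (F i z) = f i z := by
  have sel : ∃ j, 1 / 2 ≤ bary j (F i z) ∧ glue f (F i z) = f j (Finv j (F i z)) := by
    have hs := bary_sum (F i z)
    rw [glue]
    split_ifs with h0 h1
    · exact ⟨0, h0, rfl⟩
    · exact ⟨1, h1, rfl⟩
    · refine ⟨2, ?_, rfl⟩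
      have : i = 2 := by
        by_contra hi
        have := bary_nonneg_of_mem_SG hz 0
        have := bary_nonneg_of_mem_SG hz 1
        rw [bary_F] at h0 h1
        fin_cases i
        · simp at h0; linarith
        · simp at h1; linarith
        · simp at hi
      subst this
      rw [bary_F, if_pos rfl]
      linarith [bary_nonneg_of_mem_SG hz 2]
  obtain ⟨j, hj, e⟩ := sel
  rw [e]
  rcases eq_or_ne i j with rfl | hij
  · rw [Finv_F]
  · rw [bary_F, if_neg hij.symm] at hj
    rw [eq_q_of_bary hz (i := j) (by linarith), F_q_comm, Finv_F, hf]

lemma glue_q {f : Fin 3 → ℝ × ℝ → ℝ} (hf : ∀ i j, f i (q j) = f j (q i)) (i : Fin 3) :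
    glue f (q i) = f i (q i) := by
  conv_lhs => rw [← F_q_self i]
  exact glue_F hf i (q_mem_SG i)

lemma continuousOn_of_comp_F {u : ℝ × ℝ → ℝ} (h : ∀ i, ContinuousOn (fun z => u (F i z)) SG) :
    ContinuousOn u SG := by
  rw [SG_eq_iUnion]
  refine (locallyFinite_of_finite _).continuousOn_iUnion
    (fun i => (isCompact_SG.image (continuous_F i)).isClosed) fun i => ?_
  have h2 : ContinuousOn (fun z => u (F i (Finv i z))) (F i '' SG) :=
    (h i).comp (continuous_Finv i).continuousOn (by rintro _ ⟨z, hz, rfl⟩; rwa [Finv_F])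
  simpa only [F_Finv] using h2

lemma continuousOn_glue {f : Fin 3 → ℝ × ℝ → ℝ} (hf : ∀ i j, f i (q j) = f j (q i))
    (hc : ∀ i, ContinuousOn (f i) SG) : ContinuousOn (glue f) SG :=
  continuousOn_of_comp_F fun i => (hc i).congr fun _ hz => glue_F hf i hz

/-! ### Graph energies -/

lemma Fw_mem_SG (m : ℕ) (w : Fin m → Fin 3) {z : ℝ × ℝ} (hz : z ∈ SG) : Fw m w z ∈ SG := by
  induction m with
  | zero => exact hz
  | succ m ih => exact F_mem_SG (ih _) _

lemma graphEnergy_zero (u v : ℝ × ℝ → ℝ) :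
    graphEnergy 0 u v = ∑ i : Fin 3, (u (q i) - u (q (i + 1))) * (v (q i) - v (q (i + 1))) := by
  simp [graphEnergy, Fw]

lemma graphEnergy_succ (m : ℕ) (u v : ℝ × ℝ → ℝ) :
    graphEnergy (m + 1) u v
      = 5 / 3 * ∑ i, graphEnergy m (fun z => u (F i z)) (fun z => v (F i z)) := by
  simp only [graphEnergy]
  rw [← (Fin.consEquiv fun _ : Fin (m + 1) => Fin 3).sum_comp, Fintype.sum_prod_type,
    Finset.mul_sum, Finset.mul_sum]
  refine Finset.sum_congr rfl fun i _ => ?_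
  rw [pow_succ', mul_assoc]
  simp [Fw, Fin.consEquiv]

lemma graphEnergy_congr {u u' v v' : ℝ × ℝ → ℝ} (hu : EqOn u u' SG) (hv : EqOn v v' SG) (m : ℕ) :
    graphEnergy m u v = graphEnergy m u' v' := by
  simp only [graphEnergy, hu (Fw_mem_SG m _ (q_mem_SG _)), hv (Fw_mem_SG m _ (q_mem_SG _))]

lemma graphEnergy_zero_right {u v : ℝ × ℝ → ℝ} (hv : ∀ z ∈ SG, v z = 0) (m : ℕ) :
    graphEnergy m u v = 0 := by
  simp [graphEnergy, hv _ (Fw_mem_SG m _ (q_mem_SG _))]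

lemma graphEnergy_sub_left (m : ℕ) (u u' v : ℝ × ℝ → ℝ) :
    graphEnergy m (fun z => u z - u' z) v = graphEnergy m u v - graphEnergy m u' v := by
  simp only [graphEnergy, ← mul_sub, ← Finset.sum_sub_distrib]
  refine congrArg _ (Finset.sum_congr rfl fun w _ => Finset.sum_congr rfl fun i _ => ?_)
  ring

lemma graphEnergy_self_nonneg (m : ℕ) (u : ℝ × ℝ → ℝ) : 0 ≤ graphEnergy m u u := by
  unfold graphEnergy
  exact mul_nonneg (by positivity)
    (Finset.sum_nonneg fun w _ => Finset.sum_nonneg fun i _ => mul_self_nonneg _)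

/-- A function without energy on the connected graph of level `m` is constant there. -/
lemma eq_of_graphEnergy_eq_zero {m : ℕ} {u : ℝ × ℝ → ℝ} (h : graphEnergy m u u = 0) :
    ∀ z ∈ V m, u z = u (q 1) := by
  induction m generalizing u with
  | zero =>
    rw [graphEnergy_zero, Fin.sum_univ_three] at h
    have h0 := mul_self_nonneg (u (q 0) - u (q (0 + 1)))
    have h1 := mul_self_nonneg (u (q 1) - u (q (1 + 1)))
    have h2 := mul_self_nonneg (u (q 2) - u (q (2 + 1)))
    have k0 : u (q 0) - u (q 1) = 0 := mul_self_eq_zero.1 (by simp only [zero_add] at *; linarith)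
    have k1 : u (q 1) - u (q 2) = 0 :=
      mul_self_eq_zero.1 (by rw [show (1 : Fin 3) + 1 = 2 from rfl] at *; linarith)
    rintro _ ⟨i, rfl⟩
    fin_cases i <;> simp only [Fin.zero_eta, Fin.mk_one, Fin.reduceFinMk] <;> linarith
  | succ m ih =>
    rw [graphEnergy_succ] at h
    have h' : ∀ i, graphEnergy m (fun z => u (F i z)) (fun z => u (F i z)) = 0 := fun i =>
      (Finset.sum_eq_zero_iff_of_nonneg fun i _ => graphEnergy_self_nonneg m _).1
        ((mul_eq_zero_iff_left (by norm_num)).1 h) i (Finset.mem_univ i)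
    have k : ∀ i, ∀ z ∈ V m, u (F i z) = u (F i (q 1)) := fun i => ih (h' i)
    intro z hz
    obtain ⟨i, z', hz', rfl⟩ := mem_iUnion.1 hz
    rw [k i z' hz', F_q_comm, k 1 _ (q_mem_V m i), F_q_self]

/-! ### Self-similar construction of harmonic functions -/

/-- The value at `F₀ q₁` of the function on the lower domain (with a cut through `F₀ SG`) that is
harmonic, vanishes on the cut, and has the values `a` at `q₁` and `b` at `q₂`. Here `p` holds the
two normal derivatives that describe the part of the domain in `F₀ SG`. By symmetry the value at
`F₀ q₂` is `upperValue p b a`. -/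
noncomputable def upperValue (p : ℝ × ℝ) (a b : ℝ) : ℝ :=
  (3 / (3 + 2 * (p.1 - p.2)) * (a + b) + 1 / (2 + (p.1 + p.2)) * (a - b)) / 2

lemma upperValue_neg (p : ℝ × ℝ) (a b : ℝ) : upperValue p (-a) (-b) = -upperValue p a b := by
  simp only [upperValue]; ring

lemma upperValue_le {p : ℝ × ℝ} (hp : Admissible 1 p) {a b M : ℝ} (hM : 0 ≤ M) (ha : a ≤ M)
    (hb : b ≤ M) : upperValue p a b ≤ 3 / 5 * M := by
  obtain ⟨h1, h2⟩ := hp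
  have h3 : 3 / (3 + 2 * (p.1 - p.2)) ≤ 3 / 5 := by gcongr; linarith
  have h4 : 1 / (2 + (p.1 + p.2)) ≤ 3 / (3 + 2 * (p.1 - p.2)) := by
    rw [div_le_div_iff₀ (by linarith) (by linarith)]; linarith
  have h5 : 0 ≤ 1 / (2 + (p.1 + p.2)) := div_nonneg zero_le_one (by linarith)
  rw [upperValue]
  nlinarith [mul_nonneg (sub_nonneg.2 h4) (sub_nonneg.2 hb),
    mul_nonneg (add_nonneg h5 (h5.trans h4)) (sub_nonneg.2 ha), mul_nonneg (sub_nonneg.2 h3) hM]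

lemma le_upperValue {p : ℝ × ℝ} (hp : Admissible 1 p) {a b M : ℝ} (hM : M ≤ 0) (ha : M ≤ a)
    (hb : M ≤ b) : 3 / 5 * M ≤ upperValue p a b := by
  have := upperValue_le hp (neg_nonneg.2 hM) (neg_le_neg ha) (neg_le_neg hb)
  rw [upperValue_neg] at this
  linarith

/-- The value at `F₁ q₂` of the same function if the cut passes through `F₁ SG` and `F₂ SG`. -/
noncomputable def lowerValue (p : ℝ × ℝ) (a b : ℝ) : ℝ := p.2 * (a + b) / (2 * p.1)

lemma lowerValue_neg (p : ℝ × ℝ) (a b : ℝ) : lowerValue p (-a) (-b) = -lowerValue p a b := by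
  simp only [lowerValue]; ring

lemma lowerValue_le {p : ℝ × ℝ} (hp : Admissible 1 p) {a b M : ℝ} (hM : 0 ≤ M) (ha : a ≤ M)
    (hb : b ≤ M) : lowerValue p a b ≤ M := by
  obtain ⟨h1, h2⟩ := hp
  rw [lowerValue, div_le_iff₀ (by linarith)]
  nlinarith [mul_nonneg h1 (sub_nonneg.2 ha), mul_nonneg h1 (sub_nonneg.2 hb)]

lemma le_lowerValue {p : ℝ × ℝ} (hp : Admissible 1 p) {a b M : ℝ} (hM : M ≤ 0) (ha : M ≤ a)
    (hb : M ≤ b) : M ≤ lowerValue p a b := by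
  have := lowerValue_le hp (neg_nonneg.2 hM) (neg_le_neg ha) (neg_le_neg hb)
  rw [lowerValue_neg] at this
  linarith

/-- Names for the functions that are constructed: `harm A` is the harmonic function on the gasket
with the boundary values `A`, and `low t a b` is the function that is harmonic in the lower domain
of `t`, vanishes above it, and has the values `a` at `q₁` and `b` at `q₂`. -/
inductive Datum
  | harm (A : Fin 3 → ℝ)
  | low (t a b : ℝ)

namespace Datum

/-- The values at the corners `q i`. -/
noncomputable def corner : Datum → Fin 3 → ℝ
  | harm A => A
  | low _ a b => ![0, a, b]

/-- The function named by `s`, restricted to the cell `F i SG` and scaled up, is named by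
`s.sub i`. -/
noncomputable def sub : Datum → Fin 3 → Datum
  | harm A, i => harm fun j => if i = j then A i else (A 0 + A 1 + A 2 + A i + A j) / 5
  | low t a b, i =>
    if t < 1 / 2 then
      ![low (S t) (upperValue (etaLim (S t)) a b) (upperValue (etaLim (S t)) b a),
        harm ![upperValue (etaLim (S t)) a b, a,
          (a + b + upperValue (etaLim (S t)) a b + upperValue (etaLim (S t)) b a) / 4],
        harm ![upperValue (etaLim (S t)) b a,
          (a + b + upperValue (etaLim (S t)) a b + upperValue (etaLim (S t)) b a) / 4, b]] i
    else
      ![harm 0, low (S t) a (lowerValue (etaLim (S t)) a b),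
        low (S t) (lowerValue (etaLim (S t)) a b) b] i

/-- The parameter of the cut lies in `[0, 1)`. -/
def Valid : Datum → Prop
  | harm _ => True
  | low t _ _ => t ∈ Ico (0 : ℝ) 1

lemma Valid.sub {s : Datum} (hs : s.Valid) (i : Fin 3) : (s.sub i).Valid := by
  rcases s with A | ⟨t, a, b⟩
  · trivial
  · have := S_mem hs
    simp only [Datum.sub]
    split_ifs <;> fin_cases i <;> simp [Valid] <;> exact this

lemma corner_sub_self (s : Datum) (i : Fin 3) : (s.sub i).corner i = s.corner i := by
  rcases s with A | ⟨t, a, b⟩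
  · simp [sub, corner]
  · simp only [sub]
    split_ifs <;> fin_cases i <;> simp [corner]

lemma corner_sub_comm (s : Datum) (i j : Fin 3) : (s.sub i).corner j = (s.sub j).corner i := by
  rcases s with A | ⟨t, a, b⟩
  · simp only [sub, corner]
    rcases eq_or_ne i j with rfl | h
    · rfl
    · rw [if_neg h, if_neg h.symm]; ring
  · simp only [sub]
    split_ifs <;> fin_cases i <;> fin_cases j <;> simp [corner]

lemma corner_sub_mem {s : Datum} (hs : s.Valid) {lo hi : ℝ}
    (h : ∀ i, s.corner i ∈ Icc lo hi) (i j : Fin 3) : (s.sub i).corner j ∈ Icc lo hi := by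
  rcases s with A | ⟨t, a, b⟩
  · simp only [sub, corner] at h ⊢
    have h0 := h 0
    have h1 := h 1
    have h2 := h 2
    simp only [mem_Icc] at h0 h1 h2 ⊢
    fin_cases i <;> fin_cases j <;> simp <;> constructor <;> linarith
  · have h0 := h 0
    have h1 := h 1
    have h2 := h 2
    have hp := etaLim_admissible (S_mem hs)
    simp only [corner, Matrix.cons_val, mem_Icc] at h0 h1 h2
    have u1 := upperValue_le hp h0.2 h1.2 h2.2
    have u2 := upperValue_le hp h0.2 h2.2 h1.2
    have l1 := le_upperValue hp h0.1 h1.1 h2.1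
    have l2 := le_upperValue hp h0.1 h2.1 h1.1
    have v1 := lowerValue_le hp h0.2 h1.2 h2.2
    have v2 := le_lowerValue hp h0.1 h1.1 h2.1
    simp only [sub, mem_Icc]
    split_ifs <;> fin_cases i <;> fin_cases j <;> simp [corner] <;> constructor <;> linarith

/-- The approximations of the function named by `s`: apply `sub` `n` times, then interpolate the
corner values linearly. -/
noncomputable def approx : ℕ → Datum → ℝ × ℝ → ℝ
  | 0, s => fun z => ∑ i, s.corner i * bary i z
  | n + 1, s => glue fun i => approx n (s.sub i)

lemma approx_q (n : ℕ) (s : Datum) (i : Fin 3) : approx n s (q i) = s.corner i := by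
  induction n generalizing s i with
  | zero => simp [approx, bary_q]
  | succ n ih =>
    rw [approx, glue_q fun i j => by rw [ih, ih, corner_sub_comm], ih, corner_sub_self]

lemma approx_compat (n : ℕ) (s : Datum) (i j : Fin 3) :
    approx n (s.sub i) (q j) = approx n (s.sub j) (q i) := by
  rw [approx_q, approx_q, corner_sub_comm]

lemma approx_F (n : ℕ) (s : Datum) (i : Fin 3) {z : ℝ × ℝ} (hz : z ∈ SG) :
    approx (n + 1) s (F i z) = approx n (s.sub i) z := glue_F (approx_compat n s) i hz

lemma continuousOn_approx (n : ℕ) (s : Datum) : ContinuousOn (approx n s) SG := by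
  induction n generalizing s with
  | zero =>
    exact (continuous_finsetSum _ fun i _ =>
      continuous_const.mul (continuous_bary i)).continuousOn
  | succ n ih => exact continuousOn_glue (approx_compat n s) fun i => ih _

lemma approx_mem (n : ℕ) {s : Datum} (hs : s.Valid) {lo hi : ℝ}
    (h : ∀ i, s.corner i ∈ Icc lo hi) {z : ℝ × ℝ} (hz : z ∈ SG) : approx n s z ∈ Icc lo hi := by
  induction n generalizing s z with
  | zero =>
    have hb := bary_nonneg_of_mem_SG hz
    have hsum := bary_sum z
    have e1 : ∀ c : ℝ, c = c * bary 0 z + c * bary 1 z + c * bary 2 z := fun c => by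
      rw [← mul_add, ← mul_add, hsum, mul_one]
    simp only [approx, Fin.sum_univ_three, mem_Icc]
    constructor
    · rw [e1 lo]
      gcongr
      exacts [hb 0, (h 0).1, hb 1, (h 1).1, hb 2, (h 2).1]
    · rw [e1 hi]
      gcongr
      exacts [hb 0, (h 0).2, hb 1, (h 1).2, hb 2, (h 2).2]
  | succ n ih =>
    obtain ⟨i, z', hz', rfl⟩ := exists_F_of_mem_SG hz
    rw [approx_F n s i hz']
    exact ih (hs.sub i) (corner_sub_mem hs h i) hz'

/-- The approximations differ from each other by at most `ε` from some index on. -/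
def CauchyWithin (ε : ℝ) (s : Datum) : Prop :=
  ∃ n, ∀ m ≥ n, ∀ m' ≥ n, ∀ z ∈ SG, |approx m s z - approx m' s z| ≤ ε

lemma CauchyWithin.of_sub {ε : ℝ} {s : Datum} (h : ∀ i, CauchyWithin ε (s.sub i)) :
    CauchyWithin ε s := by
  choose n hn using h
  refine ⟨n 0 + n 1 + n 2 + 1, fun m hm m' hm' z hz => ?_⟩
  obtain ⟨i, z', hz', rfl⟩ := exists_F_of_mem_SG hz
  have hi : n i ≤ n 0 + n 1 + n 2 := by fin_cases i <;> simp <;> omega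
  obtain ⟨m, rfl⟩ := Nat.exists_eq_add_of_le' (by omega : 1 ≤ m)
  obtain ⟨m', rfl⟩ := Nat.exists_eq_add_of_le' (by omega : 1 ≤ m')
  rw [approx_F _ _ _ hz', approx_F _ _ _ hz']
  exact hn i m (by omega) m' (by omega) z' hz'

lemma CauchyWithin.of_corner {s : Datum} (hs : s.Valid) {lo hi : ℝ}
    (h : ∀ i, s.corner i ∈ Icc lo hi) : CauchyWithin (hi - lo) s := by
  refine ⟨0, fun m _ m' _ z hz => ?_⟩
  have h1 := approx_mem m hs h hz
  have h2 := approx_mem m' hs h hz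
  rw [abs_le]
  constructor <;> linarith [h1.1, h1.2, h2.1, h2.2]

lemma cauchyWithin_harm {ε : ℝ} (hε : 0 < ε) (A : Fin 3 → ℝ) : CauchyWithin ε (harm A) := by
  have key : ∀ k : ℕ, ∀ A : Fin 3 → ℝ, ∀ lo hi, (∀ i, A i ∈ Icc lo hi) →
      (3 / 5) ^ k * (hi - lo) ≤ ε → CauchyWithin ε (harm A) := by
    intro k
    induction k with
    | zero =>
      intro A lo hi h hk
      obtain ⟨n, hn⟩ := CauchyWithin.of_corner (s := harm A) trivial h
      exact ⟨n, fun m hm m' hm' z hz => (hn m hm m' hm' z hz).trans (by linarith)⟩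
    | succ k ih =>
      intro A lo hi h hk
      refine CauchyWithin.of_sub fun i => ih _ ((2 * A i + 3 * lo) / 5) ((2 * A i + 3 * hi) / 5)
        (fun j => ?_) (by rw [pow_succ] at hk; linarith)
      have h0 := h 0
      have h1 := h 1
      have h2 := h 2
      simp only [mem_Icc] at h0 h1 h2 ⊢
      fin_cases i <;> fin_cases j <;> simp <;> constructor <;> linarith
  set M := |A 0| + |A 1| + |A 2| with hM
  have hA : ∀ i, A i ∈ Icc (-M) M := by
    intro i
    have h0 := abs_nonneg (A 0)
    have h1 := abs_nonneg (A 1)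
    have h2 := abs_nonneg (A 2)
    rw [mem_Icc, ← abs_le]
    fin_cases i <;> simp <;> linarith
  have hM0 : 0 ≤ M := by positivity
  obtain ⟨k, hk⟩ := exists_pow_lt_of_lt_one (show 0 < ε / (M - -M + 1) from div_pos hε (by linarith))
    (by norm_num : (3 / 5 : ℝ) < 1)
  refine key k A _ _ hA ?_
  rw [lt_div_iff₀ (by linarith)] at hk
  have : (0 : ℝ) ≤ (3 / 5) ^ k := by positivity
  linarith

lemma cauchyWithin_low {ε : ℝ} (hε : 0 < ε) {t : ℝ} (ht : t ∈ Ico (0 : ℝ) 1) (a b : ℝ) :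
    CauchyWithin ε (low t a b) := by
  have key : ∀ n : ℕ, ∀ t ∈ Ico (0 : ℝ) 1, ∀ a b M : ℝ, |a| ≤ M → |b| ≤ M →
      (3 / 5) ^ zeroCount t n * M ≤ ε / 2 → CauchyWithin ε (low t a b) := by
    intro n
    induction n with
    | zero =>
      intro t ht a b M ha hb hM
      simp only [zeroCount, pow_zero, one_mul] at hM
      have ha' := abs_le.1 ha
      have hb' := abs_le.1 hb
      have := CauchyWithin.of_corner (s := low t a b) ht (lo := -(ε / 2)) (hi := ε / 2)
        (fun i => by
          simp only [corner, mem_Icc]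
          constructor <;> fin_cases i <;> simp <;> linarith)
      convert this using 1
      ring
    | succ n ih =>
      intro t ht a b M ha hb hM
      have hM0 : 0 ≤ M := (abs_nonneg a).trans ha
      have hp := etaLim_admissible (S_mem ht)
      have ha' := abs_le.1 ha
      have hb' := abs_le.1 hb
      refine CauchyWithin.of_sub fun i => ?_
      simp only [sub]
      rw [zeroCount] at hM
      split_ifs with h
      · rw [if_pos h, pow_add, pow_one, mul_right_comm, mul_comm (3 / 5 * M)] at hM
        have := ih (S t) (S_mem ht) (upperValue (etaLim (S t)) a b)
          (upperValue (etaLim (S t)) b a) (3 / 5 * M)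
          (abs_le.2 ⟨by linarith [le_upperValue hp (by linarith) ha'.1 hb'.1],
            upperValue_le hp hM0 ha'.2 hb'.2⟩)
          (abs_le.2 ⟨by linarith [le_upperValue hp (by linarith) hb'.1 ha'.1],
            upperValue_le hp hM0 hb'.2 ha'.2⟩) hM
        fin_cases i
        · exact this
        · exact cauchyWithin_harm hε _
        · exact cauchyWithin_harm hε _
      · rw [if_neg h, zero_add] at hM
        have hc : |lowerValue (etaLim (S t)) a b| ≤ M :=
          abs_le.2 ⟨le_lowerValue hp (by linarith) ha'.1 hb'.1, lowerValue_le hp hM0 ha'.2 hb'.2⟩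
        fin_cases i
        · exact cauchyWithin_harm hε _
        · exact ih (S t) (S_mem ht) _ _ M ha hc hM
        · exact ih (S t) (S_mem ht) _ _ M hc hb hM
  have hM0 : 0 ≤ |a| + |b| := by positivity
  obtain ⟨k, hk⟩ := exists_pow_lt_of_lt_one (show 0 < ε / 2 / (|a| + |b| + 1) by positivity)
    (by norm_num : (3 / 5 : ℝ) < 1)
  obtain ⟨n, hn⟩ := zeroCount_unbounded k t ht
  refine key n t ht a b (|a| + |b|) (by linarith [abs_nonneg b]) (by linarith [abs_nonneg a]) ?_
  rw [lt_div_iff₀ (by linarith)] at hk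
  have h1 : (3 / 5 : ℝ) ^ zeroCount t n ≤ (3 / 5) ^ k :=
    pow_le_pow_of_le_one (by norm_num) (by norm_num) hn
  have : (0 : ℝ) ≤ (3 / 5) ^ k := by positivity
  nlinarith

lemma Valid.cauchyWithin {s : Datum} (hs : s.Valid) {ε : ℝ} (hε : 0 < ε) : CauchyWithin ε s := by
  rcases s with A | ⟨t, a, b⟩
  · exact cauchyWithin_harm hε A
  · exact cauchyWithin_low hε hs a b

/-- The function named by `s`. -/
noncomputable def fn (s : Datum) (z : ℝ × ℝ) : ℝ := limUnder atTop fun n => approx n s z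

lemma uniformCauchySeqOn_approx {s : Datum} (hs : s.Valid) :
    UniformCauchySeqOn (fun n => approx n s) atTop SG := by
  rw [Metric.uniformCauchySeqOn_iff]
  intro ε hε
  obtain ⟨n, hn⟩ := hs.cauchyWithin (half_pos hε)
  exact ⟨n, fun m hm m' hm' z hz => by
    rw [Real.dist_eq]; linarith [hn m hm m' hm' z hz]⟩

lemma tendsto_approx {s : Datum} (hs : s.Valid) {z : ℝ × ℝ} (hz : z ∈ SG) :
    Tendsto (fun n => approx n s z) atTop (𝓝 (s.fn z)) :=
  ((uniformCauchySeqOn_approx hs).cauchySeq hz).tendsto_limUnder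

lemma continuousOn_fn {s : Datum} (hs : s.Valid) : ContinuousOn s.fn SG :=
  ((uniformCauchySeqOn_approx hs).tendstoUniformlyOn_of_tendsto
    fun _ hz => tendsto_approx hs hz).continuousOn
      (Eventually.of_forall fun n => continuousOn_approx n s).frequently

lemma fn_F {s : Datum} (hs : s.Valid) (i : Fin 3) {z : ℝ × ℝ} (hz : z ∈ SG) :
    s.fn (F i z) = (s.sub i).fn z := by
  have h := (tendsto_add_atTop_iff_nat 1).2 (tendsto_approx hs (F_mem_SG hz i))
  simp only [approx_F _ _ _ hz] at h
  exact tendsto_nhds_unique h (tendsto_approx (hs.sub i) hz)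

lemma fn_q {s : Datum} (hs : s.Valid) (i : Fin 3) : s.fn (q i) = s.corner i := by
  have h := tendsto_approx hs (q_mem_SG i)
  simp only [approx_q] at h
  exact tendsto_nhds_unique h tendsto_const_nhds

lemma fn_mem {s : Datum} (hs : s.Valid) {lo hi : ℝ}
    (h : ∀ i, s.corner i ∈ Icc lo hi) {z : ℝ × ℝ} (hz : z ∈ SG) : s.fn z ∈ Icc lo hi :=
  isClosed_Icc.mem_of_tendsto (tendsto_approx hs hz)
    (Eventually.of_forall fun n => approx_mem n hs h hz)

lemma fn_harm_zero {A : Fin 3 → ℝ} (hA : ∀ i, A i = 0) {z : ℝ × ℝ} (hz : z ∈ SG) :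
    (harm A).fn z = 0 := by
  have := fn_mem (s := harm A) trivial (lo := 0) (hi := 0) (fun i => by simp [corner, hA]) hz
  simpa using this

end Datum

namespace Datum

/-! ### Energies and normal derivatives of the constructed functions -/

lemma upperValue_balance {p : ℝ × ℝ} (hp : Admissible 1 p) (a b : ℝ) :
    p.1 * upperValue p a b - p.2 * upperValue p b a + 2 * upperValue p a b
      = a + (a + b + upperValue p a b + upperValue p b a) / 4 := by
  obtain ⟨h1, h2⟩ := hp
  have k1 : 3 + 2 * (p.1 - p.2) ≠ 0 := by linarith
  have k2 : 2 + (p.1 + p.2) ≠ 0 := by linarith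
  simp only [upperValue]
  field_simp
  ring

lemma upperValue_flux {p : ℝ × ℝ} (hp : Admissible 1 p) (a b : ℝ) :
    5 / 3 * (2 * a - upperValue p a b - (a + b + upperValue p a b + upperValue p b a) / 4)
      = (T₀ p).1 * a - (T₀ p).2 * b := by
  obtain ⟨h1, h2⟩ := hp
  have k1 : 3 + 2 * (p.1 - p.2) ≠ 0 := by linarith
  have k2 : 2 + (p.1 + p.2) ≠ 0 := by linarith
  have k3 : 3 + 2 * p.1 - 2 * p.2 ≠ 0 := by linarith
  have k4 : 2 + p.1 + p.2 ≠ 0 := by linarith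
  have e1 : 3 + 2 * (p.1 - p.2) = 3 + 2 * p.1 - 2 * p.2 := by ring
  have e2 : 2 + (p.1 + p.2) = 2 + p.1 + p.2 := by ring
  simp only [upperValue, T₀, e1, e2]
  field_simp
  ring

lemma upperValue_comm_sum (p : ℝ × ℝ) (a b : ℝ) :
    b + a + upperValue p b a + upperValue p a b = a + b + upperValue p a b + upperValue p b a := by
  ring

lemma lowerValue_balance {p : ℝ × ℝ} (hp : Admissible 1 p) (a b : ℝ) :
    2 * p.1 * lowerValue p a b = p.2 * (a + b) := by
  obtain ⟨h1, h2⟩ := hp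
  have k1 : 2 * p.1 ≠ 0 := by linarith
  rw [lowerValue, mul_div_cancel₀ _ k1]

lemma lowerValue_flux {p : ℝ × ℝ} (hp : Admissible 1 p) (a b : ℝ) :
    5 / 3 * (p.1 * a - p.2 * lowerValue p a b) = (T₁ p).1 * a - (T₁ p).2 * b := by
  obtain ⟨h1, h2⟩ := hp
  have k1 : p.1 ≠ 0 := by linarith
  simp only [lowerValue, T₁]
  field_simp
  ring

lemma lowerValue_comm (p : ℝ × ℝ) (a b : ℝ) : lowerValue p b a = lowerValue p a b := by
  simp only [lowerValue, add_comm]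

lemma fn_comp_F {s : Datum} (hs : s.Valid) (i : Fin 3) :
    EqOn (fun z => s.fn (F i z)) (s.sub i).fn SG := fun _ hz => fn_F hs i hz

lemma sub_low_of_lt {t : ℝ} (h : t < 1 / 2) (a b : ℝ) : (low t a b).sub =
    ![low (S t) (upperValue (etaLim (S t)) a b) (upperValue (etaLim (S t)) b a),
      harm ![upperValue (etaLim (S t)) a b, a,
        (a + b + upperValue (etaLim (S t)) a b + upperValue (etaLim (S t)) b a) / 4],
      harm ![upperValue (etaLim (S t)) b a,
        (a + b + upperValue (etaLim (S t)) a b + upperValue (etaLim (S t)) b a) / 4, b]] := by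
  funext i; simp only [sub, if_pos h]

lemma sub_low_of_ge {t : ℝ} (h : 1 / 2 ≤ t) (a b : ℝ) : (low t a b).sub =
    ![harm 0, low (S t) a (lowerValue (etaLim (S t)) a b),
      low (S t) (lowerValue (etaLim (S t)) a b) b] := by
  funext i; simp only [sub, if_neg (not_lt.2 h)]

lemma graphEnergy_fn_succ {s : Datum} (hs : s.Valid) (m : ℕ) (v : ℝ × ℝ → ℝ) :
    graphEnergy (m + 1) s.fn v =
      5 / 3 * ∑ i, graphEnergy m (s.sub i).fn (fun z => v (F i z)) := by
  rw [graphEnergy_succ]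
  congr 1
  exact Finset.sum_congr rfl fun i _ => graphEnergy_congr (fn_comp_F hs i) (fun _ _ => rfl) m

/-- The energy of a harmonic function with any `v` is already attained on the coarsest graph. -/
lemma graphEnergy_harm (m : ℕ) (A : Fin 3 → ℝ) (v : ℝ × ℝ → ℝ) :
    graphEnergy m (harm A).fn v
      = ∑ i : Fin 3, (A i - A (i + 1)) * (v (q i) - v (q (i + 1))) := by
  induction m generalizing A v with
  | zero => simp only [graphEnergy_zero, fn_q (s := harm A) trivial, corner]
  | succ m ih =>
    rw [graphEnergy_fn_succ (s := harm A) trivial]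
    simp only [sub, ih, Fin.sum_univ_three, F_q_self, F_q_comm 1 0, F_q_comm 2 0, F_q_comm 2 1,
      show (0 : Fin 3) + 1 = 1 from rfl, show (1 : Fin 3) + 1 = 2 from rfl,
      show (2 : Fin 3) + 1 = 0 from rfl, Fin.isValue, if_true, Fin.reduceEq, if_false]
    ring

/-- Green's formula: against a test function that vanishes near and above the cut, only the
boundary terms at `q₁` and `q₂` remain, and their coefficients are the normal derivatives. -/
lemma graphEnergy_low (n : ℕ) {t : ℝ} (ht : t ∈ Ico (0 : ℝ) 1) (a b : ℝ) {v : ℝ × ℝ → ℝ}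
    (hv : ∀ z ∈ SG, 1 - t - (1 / 2) ^ n ≤ z.2 → v z = 0) {m : ℕ} (hm : n ≤ m) :
    graphEnergy m (low t a b).fn v
      = ((etaLim t).1 * a - (etaLim t).2 * b) * v (q 1)
        + ((etaLim t).1 * b - (etaLim t).2 * a) * v (q 2) := by
  induction n generalizing t a b v m with
  | zero =>
    have hv0 : ∀ z ∈ SG, v z = 0 := fun z hz => hv z hz (by
      have := bary_nonneg_of_mem_SG hz 0
      rw [bary_zero] at this
      norm_num
      linarith [ht.1])
    rw [graphEnergy_zero_right hv0, hv0 _ (q_mem_SG 1), hv0 _ (q_mem_SG 2)]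
    ring
  | succ n ih =>
    obtain ⟨m, rfl⟩ := Nat.exists_eq_add_of_le' (by omega : 1 ≤ m)
    have hm' : n ≤ m := by omega
    have hp := etaLim_admissible (S_mem ht)
    rw [graphEnergy_fn_succ (s := low t a b) ht, Fin.sum_univ_three]
    have hv' : ∀ i : Fin 3, ∀ z ∈ SG,
        2 * (1 - t) - (1 / 2) ^ n - (if i = 0 then 1 else 0) ≤ z.2 → v (F i z) = 0 := by
      intro i z hz h
      refine hv _ (F_mem_SG hz i) ?_
      rw [F_snd, pow_succ]
      linarith
    rcases lt_or_ge t (1 / 2) with h | h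
    · have hv0 : ∀ z ∈ SG, 1 - S t - (1 / 2) ^ n ≤ z.2 → v (F 0 z) = 0 := fun z hz hz' =>
        hv' 0 z hz (by rw [S_of_lt ht.1 h] at hz'; simp only [if_true]; linarith)
      rw [sub_low_of_lt h, etaLim_of_lt ht.1 h]
      simp only [Matrix.cons_val]
      rw [ih (S_mem ht) _ _ hv0 hm', graphEnergy_harm, graphEnergy_harm]
      have e1 := upperValue_balance hp a b
      have e2 := upperValue_balance hp b a
      have e3 := upperValue_flux hp a b
      have e4 := upperValue_flux hp b a
      rw [upperValue_comm_sum] at e2 e4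
      simp only [Fin.sum_univ_three, F_q_self, F_q_comm 1 0, F_q_comm 2 0, F_q_comm 2 1,
        show (0 : Fin 3) + 1 = 1 from rfl, show (1 : Fin 3) + 1 = 2 from rfl,
        show (2 : Fin 3) + 1 = 0 from rfl, Matrix.cons_val]
      linear_combination v (q 1) * e3 + v (q 2) * e4 + 5 / 3 * v (F 0 (q 1)) * e1
        + 5 / 3 * v (F 0 (q 2)) * e2
    · have hv1 : ∀ i : Fin 3, i ≠ 0 → ∀ z ∈ SG, 1 - S t - (1 / 2) ^ n ≤ z.2 → v (F i z) = 0 :=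
        fun i hi z hz hz' =>
        hv' i z hz (by rw [S_of_ge h ht.2] at hz'; rw [if_neg hi]; linarith)
      rw [sub_low_of_ge h, etaLim_of_ge h ht.2]
      simp only [Matrix.cons_val]
      rw [ih (S_mem ht) _ _ (hv1 1 (by decide)) hm', ih (S_mem ht) _ _ (hv1 2 (by decide)) hm',
        graphEnergy_harm]
      have e1 := lowerValue_balance hp a b
      have e3 := lowerValue_flux hp a b
      have e4 := lowerValue_flux hp b a
      rw [lowerValue_comm] at e4
      simp only [Fin.sum_univ_three, F_q_self, F_q_comm 2 1, Pi.zero_apply]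
      linear_combination v (q 1) * e3 + v (q 2) * e4 + 5 / 3 * v (F 1 (q 2)) * e1

lemma fn_low_eq_zero {t : ℝ} (ht : t ∈ Ico (0 : ℝ) 1) (a b : ℝ) {z : ℝ × ℝ} (hz : z ∈ SG)
    (h : 1 - t ≤ z.2) : (low t a b).fn z = 0 := by
  have key : ∀ n : ℕ, ∀ t ∈ Ico (0 : ℝ) 1, ∀ a b M : ℝ, |a| ≤ M → |b| ≤ M → ∀ z ∈ SG,
      1 - t ≤ z.2 → |(low t a b).fn z| ≤ (3 / 5) ^ zeroCount t n * M := by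
    intro n
    induction n with
    | zero =>
      intro t ht a b M ha hb z hz _
      simp only [zeroCount, pow_zero, one_mul]
      have hM0 : 0 ≤ M := (abs_nonneg a).trans ha
      have ha' := abs_le.1 ha
      have hb' := abs_le.1 hb
      exact abs_le.2 (fn_mem (s := low t a b) ht (lo := -M) (hi := M) (fun i => by
        simp only [corner, mem_Icc]
        constructor <;> fin_cases i <;> simp <;> linarith) hz)
    | succ n ih =>
      intro t ht a b M ha hb z hz h
      have hM0 : 0 ≤ M := (abs_nonneg a).trans ha
      have hp := etaLim_admissible (S_mem ht)
      have ha' := abs_le.1 ha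
      have hb' := abs_le.1 hb
      obtain ⟨i, z', hz', rfl⟩ := exists_F_of_mem_SG hz
      have hle : z'.2 ≤ 1 := bary_le_one_of_mem_SG hz' 0
      rw [fn_F (s := low t a b) ht i hz', zeroCount]
      rw [F_snd] at h
      rcases lt_or_ge t (1 / 2) with h2 | h2
      · rw [sub_low_of_lt h2, if_pos h2, pow_add, pow_one, mul_right_comm,
          mul_comm (3 / 5 * M)]
        have hi : i = 0 := by
          by_contra hi
          rw [if_neg hi] at h
          linarith
        subst hi
        simp only [if_true] at h
        exact ih _ (S_mem ht) _ _ (3 / 5 * M)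
          (abs_le.2 ⟨by linarith [le_upperValue hp (by linarith) ha'.1 hb'.1],
            upperValue_le hp hM0 ha'.2 hb'.2⟩)
          (abs_le.2 ⟨by linarith [le_upperValue hp (by linarith) hb'.1 ha'.1],
            upperValue_le hp hM0 hb'.2 ha'.2⟩) z' hz' (by rw [S_of_lt ht.1 h2]; linarith)
      · rw [sub_low_of_ge h2, if_neg (not_lt.2 h2), zero_add]
        have hc : |lowerValue (etaLim (S t)) a b| ≤ M :=
          abs_le.2 ⟨le_lowerValue hp (by linarith) ha'.1 hb'.1, lowerValue_le hp hM0 ha'.2 hb'.2⟩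
        fin_cases i
        · simp only [Fin.zero_eta, Matrix.cons_val]
          rw [fn_harm_zero (A := 0) (fun _ => rfl) hz', abs_zero]
          positivity
        · exact ih _ (S_mem ht) _ _ M ha hc z' hz' (by
            simp at h
            rw [S_of_ge h2 ht.2]; linarith)
        · exact ih _ (S_mem ht) _ _ M hc hb z' hz' (by
            simp at h
            rw [S_of_ge h2 ht.2]; linarith)
  by_contra hne
  have hpos := abs_pos.2 hne
  have hM : 0 ≤ |a| + |b| := by positivity
  obtain ⟨k, hk⟩ := exists_pow_lt_of_lt_one
    (show 0 < |(low t a b).fn z| / (|a| + |b| + 1) by positivity) (by norm_num : (3 / 5 : ℝ) < 1)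
  obtain ⟨n, hn⟩ := zeroCount_unbounded k t ht
  have h1 := key n t ht a b (|a| + |b|) (by linarith [abs_nonneg b]) (by linarith [abs_nonneg a])
    z hz h
  rw [lt_div_iff₀ (by linarith)] at hk
  have h2 : (3 / 5 : ℝ) ^ zeroCount t n ≤ (3 / 5) ^ k :=
    pow_le_pow_of_le_one (by norm_num) (by norm_num) hn
  have : (0 : ℝ) ≤ (3 / 5) ^ k := by positivity
  nlinarith

end Datum

lemma iterate_F_mem_SG (i : Fin 3) (m : ℕ) {z : ℝ × ℝ} (hz : z ∈ SG) : (F i)^[m] z ∈ SG := by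
  induction m with
  | zero => exact hz
  | succ m ih => rw [Function.iterate_succ_apply']; exact F_mem_SG ih i

lemma normalQuotient_succ (u : ℝ × ℝ → ℝ) (i : Fin 3) (m : ℕ) :
    normalQuotient u i (m + 1) = 5 / 3 * normalQuotient (fun z => u (F i z)) i m := by
  simp only [normalQuotient, Function.iterate_succ_apply', F_q_self, pow_succ]
  ring

lemma normalQuotient_congr {u u' : ℝ × ℝ → ℝ} (h : EqOn u u' SG) (i : Fin 3) (m : ℕ) :
    normalQuotient u i m = normalQuotient u' i m := by
  simp only [normalQuotient, h (iterate_F_mem_SG i m (q_mem_SG _)), h (q_mem_SG i)]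

namespace Datum

lemma normalQuotient_fn_succ {s : Datum} (hs : s.Valid) (i : Fin 3) (m : ℕ) :
    normalQuotient s.fn i (m + 1) = 5 / 3 * normalQuotient (s.sub i).fn i m := by
  rw [normalQuotient_succ, normalQuotient_congr (fn_comp_F hs i)]

lemma normalQuotient_harm (m : ℕ) (A : Fin 3 → ℝ) (i : Fin 3) :
    normalQuotient (harm A).fn i m = 2 * A i - A (i + 1) - A (i - 1) := by
  induction m generalizing A with
  | zero => simp [normalQuotient, fn_q (s := harm A) trivial, corner]
  | succ m ih =>
    rw [normalQuotient_fn_succ (s := harm A) trivial, sub, ih]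
    fin_cases i <;> simp [show (-1 : Fin 3) = 2 from rfl] <;> ring

lemma normalQuotient_low_one : ∀ t ∈ Ico (0 : ℝ) 1, ∀ a b : ℝ, ∃ n, ∀ m ≥ n,
    normalQuotient (low t a b).fn 1 m = (etaLim t).1 * a - (etaLim t).2 * b := by
  refine leadingOnes_induction (fun t h0 h a b => ⟨1, fun m hm => ?_⟩) fun t h h1 ih a b => ?_
  · have ht : t ∈ Ico (0 : ℝ) 1 := ⟨h0, by linarith⟩
    obtain ⟨m, rfl⟩ := Nat.exists_eq_add_of_le' hm
    rw [normalQuotient_fn_succ (s := low t a b) ht, sub_low_of_lt h]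
    simp only [Matrix.cons_val]
    rw [normalQuotient_harm, etaLim_of_lt h0 h, ← upperValue_flux (etaLim_admissible (S_mem ht)),
      show (1 : Fin 3) + 1 = 2 from rfl, sub_self]
    simp only [Matrix.cons_val]
    ring
  · have ht : t ∈ Ico (0 : ℝ) 1 := ⟨by linarith, h1⟩
    obtain ⟨n, hn⟩ := ih a (lowerValue (etaLim (S t)) a b)
    refine ⟨n + 1, fun m hm => ?_⟩
    obtain ⟨m, rfl⟩ := Nat.exists_eq_add_of_le' (by omega : 1 ≤ m)
    rw [normalQuotient_fn_succ (s := low t a b) ht, sub_low_of_ge h]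
    simp only [Matrix.cons_val]
    rw [hn m (by omega), etaLim_of_ge h h1, lowerValue_flux (etaLim_admissible (S_mem ht))]

lemma normalQuotient_low_two : ∀ t ∈ Ico (0 : ℝ) 1, ∀ a b : ℝ, ∃ n, ∀ m ≥ n,
    normalQuotient (low t a b).fn 2 m = (etaLim t).1 * b - (etaLim t).2 * a := by
  refine leadingOnes_induction (fun t h0 h a b => ⟨1, fun m hm => ?_⟩) fun t h h1 ih a b => ?_
  · have ht : t ∈ Ico (0 : ℝ) 1 := ⟨h0, by linarith⟩
    obtain ⟨m, rfl⟩ := Nat.exists_eq_add_of_le' hm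
    rw [normalQuotient_fn_succ (s := low t a b) ht, sub_low_of_lt h]
    simp only [Matrix.cons_val]
    rw [normalQuotient_harm, etaLim_of_lt h0 h, ← upperValue_flux (etaLim_admissible (S_mem ht)),
      show (2 : Fin 3) + 1 = 0 from rfl, show (2 : Fin 3) - 1 = 1 from rfl]
    simp only [Matrix.cons_val]
    ring
  · have ht : t ∈ Ico (0 : ℝ) 1 := ⟨by linarith, h1⟩
    obtain ⟨n, hn⟩ := ih (lowerValue (etaLim (S t)) a b) b
    refine ⟨n + 1, fun m hm => ?_⟩
    obtain ⟨m, rfl⟩ := Nat.exists_eq_add_of_le' (by omega : 1 ≤ m)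
    rw [normalQuotient_fn_succ (s := low t a b) ht, sub_low_of_ge h]
    simp only [Matrix.cons_val]
    rw [hn m (by omega), etaLim_of_ge h h1, ← lowerValue_comm,
      lowerValue_flux (etaLim_admissible (S_mem ht))]

end Datum

/-! ### Existence -/

lemma q_one_snd : (q 1).2 = 0 := rfl

lemma q_one_ne_q_two : q 1 ≠ q 2 := by
  intro h
  have := congrArg (bary 1) h
  simp [bary_q] at this

lemma q_notMem_lowerDomain (t : ℝ) (i : Fin 3) : q i ∉ lowerDomain t := fun h => h.1.2 ⟨i, rfl⟩

lemma lowerCut_subset_cut (t : ℝ) : lowerCut t ⊆ cut t := by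
  rw [lowerCut]
  split_ifs
  · exact inter_subset_right
  · exact subset_rfl

lemma closedLowerDomain_subset_SG (t : ℝ) : closedLowerDomain t ⊆ SG := by
  rintro z (hz | hz | rfl | rfl)
  · exact hz.1.1
  · exact (lowerCut_subset_cut t hz).1
  · exact q_mem_SG 1
  · exact q_mem_SG 2

theorem isH₁_low {t : ℝ} (ht : t ∈ Ico (0 : ℝ) 1) : IsH₁ t (Datum.low t 1 0).fn where
  continuousOn := (Datum.continuousOn_fn (s := Datum.low t 1 0) ht).mono
    (closedLowerDomain_subset_SG t)
  harmonic := by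
    rintro v - ⟨K, hK, hKΩ, hv⟩
    have hvq : ∀ i, v (q i) = 0 := fun i =>
      hv _ ⟨q_mem_SG i, fun h => q_notMem_lowerDomain t i (hKΩ h)⟩
    have hn : ∃ n : ℕ, ∀ z ∈ K, z.2 < 1 - t - (1 / 2) ^ n := by
      rcases K.eq_empty_or_nonempty with rfl | hne
      · exact ⟨0, by simp⟩
      obtain ⟨z₀, hz₀, hmax⟩ := hK.exists_isMaxOn hne continuous_snd.continuousOn
      obtain ⟨n, hn⟩ := exists_pow_lt_of_lt_one (sub_pos.2 (hKΩ hz₀).2)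
        (by norm_num : (1 / 2 : ℝ) < 1)
      exact ⟨n, fun z hz => by have : z.2 ≤ z₀.2 := hmax hz; linarith⟩
    obtain ⟨n, hn⟩ := hn
    refine tendsto_const_nhds.congr' ?_
    filter_upwards [eventually_ge_atTop n] with m hm
    rw [Datum.graphEnergy_low n ht 1 0 (fun z hz h => hv z ⟨hz, fun hzK => ?_⟩) hm, hvq, hvq]
    · ring
    · exact absurd h (not_le.2 (hn z hzK))
  boundary := by
    rintro z (hz | rfl | rfl)
    · have h := lowerCut_subset_cut t hz
      rw [Datum.fn_low_eq_zero ht 1 0 h.1 h.2.ge, indicator_of_notMem]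
      rintro rfl
      have := h.2
      rw [q_one_snd] at this
      linarith [ht.2]
    · rw [Datum.fn_q (s := Datum.low t 1 0) ht]
      simp [Datum.corner]
    · rw [Datum.fn_q (s := Datum.low t 1 0) ht, indicator_of_notMem]
      · simp [Datum.corner]
      · exact fun h => q_one_ne_q_two h.symm

/-! ### Harmonic splines -/

/-- The function that is harmonic in the interior of all cells of level `m` and agrees with `f` at
the vertices of level `m`. -/
noncomputable def spline : ℕ → (ℝ × ℝ → ℝ) → ℝ × ℝ → ℝ
  | 0, f => (Datum.harm fun i => f (q i)).fn
  | m + 1, f => glue fun i => spline m fun z => f (F i z)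

lemma spline_q (m : ℕ) (f : ℝ × ℝ → ℝ) (i : Fin 3) : spline m f (q i) = f (q i) := by
  induction m generalizing f i with
  | zero => exact Datum.fn_q (s := Datum.harm _) trivial i
  | succ m ih =>
    rw [spline, glue_q fun i j => by rw [ih, ih, F_q_comm], ih, F_q_self]

lemma spline_compat (m : ℕ) (f : ℝ × ℝ → ℝ) (i j : Fin 3) :
    spline m (fun z => f (F i z)) (q j) = spline m (fun z => f (F j z)) (q i) := by
  rw [spline_q, spline_q, F_q_comm]

lemma spline_F (m : ℕ) (f : ℝ × ℝ → ℝ) (i : Fin 3) :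
    EqOn (fun z => spline (m + 1) f (F i z)) (spline m fun z => f (F i z)) SG :=
  fun _ hz => glue_F (spline_compat m f) i hz

lemma continuousOn_spline (m : ℕ) (f : ℝ × ℝ → ℝ) : ContinuousOn (spline m f) SG := by
  induction m generalizing f with
  | zero => exact Datum.continuousOn_fn (s := Datum.harm _) trivial
  | succ m ih => exact continuousOn_glue (spline_compat m f) fun i => ih _

lemma graphEnergy_comm (m : ℕ) (u v : ℝ × ℝ → ℝ) : graphEnergy m u v = graphEnergy m v u := by
  simp only [graphEnergy, mul_comm (u _ - u _)]

lemma graphEnergy_spline {m n : ℕ} (h : m ≤ n) (u f : ℝ × ℝ → ℝ) :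
    graphEnergy n u (spline m f) = graphEnergy m u f := by
  induction m generalizing n u f with
  | zero =>
    rw [graphEnergy_comm, spline, Datum.graphEnergy_harm, graphEnergy_comm, graphEnergy_zero]
  | succ m ih =>
    obtain ⟨n, rfl⟩ := Nat.exists_eq_add_of_le' (by omega : 1 ≤ n)
    rw [graphEnergy_succ, graphEnergy_succ]
    congr 1
    refine Finset.sum_congr rfl fun i _ => ?_
    rw [graphEnergy_congr (fun _ _ => rfl) (spline_F m f i), ih (by omega)]

lemma inDomEnergy_spline (m : ℕ) (f : ℝ × ℝ → ℝ) : InDomEnergy (spline m f) := by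
  refine ⟨continuousOn_spline m f, ?_⟩
  refine Tendsto.bddAbove_range (a := graphEnergy m (spline m f) f) ?_
  refine tendsto_const_nhds.congr' ?_
  filter_upwards [eventually_ge_atTop m] with n hn
  rw [graphEnergy_spline hn]

lemma dist_le_diam_SG {z z' : ℝ × ℝ} (hz : z ∈ SG) (hz' : z' ∈ SG) :
    dist z z' ≤ Metric.diam SG := Metric.dist_le_diam_of_mem isCompact_SG.isBounded hz hz'

/-- A spline vanishes on the cells at whose corners it vanishes. -/
lemma exists_of_spline_ne_zero {m : ℕ} {f : ℝ × ℝ → ℝ} {z : ℝ × ℝ} (hz : z ∈ SG)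
    (h : spline m f z ≠ 0) : ∃ p, f p ≠ 0 ∧ dist z p ≤ Metric.diam SG * (1 / 2) ^ m := by
  induction m generalizing f z with
  | zero =>
    by_contra! hc
    refine h (Datum.fn_harm_zero (fun i => ?_) hz)
    by_contra hi
    have := hc (q i) hi
    rw [pow_zero, mul_one] at this
    exact absurd (dist_le_diam_SG hz (q_mem_SG i)) (not_le.2 this)
  | succ m ih =>
    obtain ⟨i, z', hz', rfl⟩ := exists_F_of_mem_SG hz
    have e := spline_F m f i hz'
    simp only at e
    rw [e] at h
    obtain ⟨p, hp, hd⟩ := ih hz' h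
    refine ⟨F i p, hp, ?_⟩
    rw [dist_F, pow_succ]
    linarith

/-! ### Cells of level `m` -/

lemma dist_Fw (m : ℕ) (w : Fin m → Fin 3) (z z' : ℝ × ℝ) :
    dist (Fw m w z) (Fw m w z') = dist z z' * (1 / 2) ^ m := by
  induction m with
  | zero => simp [Fw]
  | succ m ih =>
    rw [Fw, Function.comp_apply, Function.comp_apply, dist_F, ih, pow_succ]
    ring

lemma exists_Fw_of_mem_SG (m : ℕ) {z : ℝ × ℝ} (hz : z ∈ SG) :
    ∃ w : Fin m → Fin 3, ∃ z' ∈ SG, Fw m w z' = z := by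
  induction m generalizing z with
  | zero => exact ⟨Fin.elim0, z, hz, rfl⟩
  | succ m ih =>
    obtain ⟨i, z', hz', rfl⟩ := exists_F_of_mem_SG hz
    obtain ⟨w, z'', hz'', rfl⟩ := ih hz'
    exact ⟨Fin.cons i w, z'', hz'', by simp [Fw]⟩

lemma continuous_Fw (m : ℕ) (w : Fin m → Fin 3) : Continuous (Fw m w) := by
  induction m with
  | zero => exact continuous_id
  | succ m ih => exact (continuous_F _).comp (ih _)

lemma Fw_q_mem_V (m : ℕ) (w : Fin m → Fin 3) (i : Fin 3) : Fw m w (q i) ∈ V m := by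
  induction m with
  | zero => exact ⟨i, rfl⟩
  | succ m ih => exact F_mem_V (ih _) _

/-- The cells of level `m` are bounded by horizontal lines at multiples of `2⁻ᵐ`. -/
lemma exists_Fw_snd (m : ℕ) (w : Fin m → Fin 3) :
    ∃ j : ℤ, ∀ z, (Fw m w z).2 = (j + z.2) / 2 ^ m := by
  induction m with
  | zero => exact ⟨0, fun z => by simp [Fw]⟩
  | succ m ih =>
    obtain ⟨j, hj⟩ := ih (Fin.tail w)
    refine ⟨j + if w 0 = 0 then 2 ^ m else 0, fun z => ?_⟩
    rw [Fw, Function.comp_apply, F_snd, hj]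
    split_ifs <;> push_cast <;> field_simp <;> ring

/-! ### The closed lower domain -/

lemma q_zero_snd : (q 0).2 = 1 := rfl

lemma mem_closedLowerDomain_of_lt {t : ℝ} (h0 : 0 ≤ t) {z : ℝ × ℝ} (hz : z ∈ SG)
    (h : z.2 < 1 - t) : z ∈ closedLowerDomain t := by
  by_cases hV : z ∈ V 0
  · obtain ⟨i, rfl⟩ := hV
    fin_cases i
    · simp only [Fin.zero_eta, q_zero_snd] at h; linarith
    · exact Or.inr (Or.inr (Or.inl rfl))
    · exact Or.inr (Or.inr (Or.inr rfl))
  · exact Or.inl ⟨⟨hz, hV⟩, h⟩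

/-- At a dyadic level `t`, the cells below the cut touch it only at vertices of `lowerCut t`, so
that the closed domain is a finite union of cells up to finitely many points. -/
lemma isClosed_closedLowerDomain {t : ℝ} (h0 : 0 ≤ t) : IsClosed (closedLowerDomain t) := by
  by_cases hd : (dyadicLevels t).Nonempty
  · have hcut : lowerCut t = V (sInf (dyadicLevels t)) ∩ cut t := if_pos hd
    obtain ⟨k, hk⟩ := Nat.sInf_mem hd
    set d := sInf (dyadicLevels t) with hd'
    have hpow : (0 : ℝ) < 2 ^ d := by positivity
    have e : closedLowerDomain t = (⋃ w ∈ {w : Fin d → Fin 3 | (Fw d w (q 0)).2 ≤ 1 - t},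
        Fw d w '' SG) ∪ lowerBoundary t := by
      apply Subset.antisymm
      · refine union_subset (fun z hz => Or.inl ?_) subset_union_right
        obtain ⟨w, z', hz', rfl⟩ := exists_Fw_of_mem_SG d hz.1.1
        refine mem_iUnion₂.2 ⟨w, ?_, z', hz', rfl⟩
        obtain ⟨j, hj⟩ := exists_Fw_snd d w
        have h2 := hz.2
        have h3 : 0 ≤ z'.2 := bary_nonneg_of_mem_SG hz' 0
        have e1 : 1 - t = (2 ^ d - k) / 2 ^ d := by rw [hk]; field_simp
        rw [hj, e1, div_lt_div_iff_of_pos_right hpow] at h2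
        rw [mem_ofPred_eq, hj, e1, div_le_div_iff_of_pos_right hpow, q_zero_snd]
        have h4 : (j : ℝ) < ((2 ^ d - k : ℤ) : ℝ) := by push_cast; linarith
        have h5 : j + 1 ≤ 2 ^ d - k := Int.cast_lt.1 h4
        exact_mod_cast h5
      · refine union_subset (iUnion₂_subset fun w hw => ?_) subset_union_right
        rintro _ ⟨z, hz, rfl⟩
        obtain ⟨j, hj⟩ := exists_Fw_snd d w
        have h3 : z.2 ≤ 1 := bary_le_one_of_mem_SG hz 0
        rw [mem_ofPred_eq, hj, q_zero_snd] at hw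
        have h4 : (Fw d w z).2 ≤ (j + 1) / 2 ^ d := by rw [hj]; gcongr
        rcases (h4.trans hw).lt_or_eq with h5 | h5
        · exact mem_closedLowerDomain_of_lt h0 (Fw_mem_SG d w hz) h5
        · have h6 : (j + 1 : ℝ) / 2 ^ d ≤ (j + z.2) / 2 ^ d := by rw [← hj, h5]; exact hw
          rw [div_le_div_iff_of_pos_right hpow] at h6
          have h7 : z = q 0 := eq_q_of_bary hz (i := 0) (by rw [bary_zero]; linarith)
          subst h7
          refine Or.inr (Or.inl ?_)
          rw [hcut]
          exact ⟨Fw_q_mem_V d w 0, Fw_mem_SG d w hz, h5⟩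
    rw [e, lowerBoundary, hcut]
    refine IsClosed.union ?_ ((((V_finite d).subset inter_subset_left).isClosed).union
      (toFinite _).isClosed)
    exact (toFinite _).isClosed_biUnion fun w _ =>
      (isCompact_SG.image (continuous_Fw d w)).isClosed
  · have hcut : lowerCut t = cut t := if_neg hd
    have e : closedLowerDomain t = (SG ∩ {z | z.2 ≤ 1 - t}) ∪ {q 1, q 2} := by
      rw [closedLowerDomain, lowerBoundary, hcut]
      ext z
      constructor
      · rintro (hz | hz | hz)
        · exact Or.inl ⟨hz.1.1, hz.2.le⟩
        · exact Or.inl ⟨hz.1, hz.2.le⟩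
        · exact Or.inr hz
      · rintro (⟨hz, hz'⟩ | hz)
        · rcases lt_or_eq_of_le (show z.2 ≤ 1 - t from hz') with h | h
          · have := mem_closedLowerDomain_of_lt h0 hz h
            rwa [closedLowerDomain, lowerBoundary, hcut] at this
          · exact Or.inr (Or.inl ⟨hz, h⟩)
        · exact Or.inr (Or.inr hz)
    rw [e]
    exact (isClosed_closure.inter (isClosed_le continuous_snd continuous_const)).union
      (toFinite _).isClosed

/-! ### Uniqueness -/

lemma graphEnergy_le_of_forall {m : ℕ} {u f : ℝ × ℝ → ℝ}
    (h : ∀ x ∈ SG, ∀ y ∈ SG, dist x y ≤ Metric.diam SG * (1 / 2) ^ m →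
      (f x - f y) * (f x - f y) ≤ (u x - u y) * (f x - f y)) :
    graphEnergy m f f ≤ graphEnergy m u f := by
  unfold graphEnergy
  refine mul_le_mul_of_nonneg_left (Finset.sum_le_sum fun w _ => Finset.sum_le_sum fun i _ => ?_)
    (by positivity)
  refine h _ (Fw_mem_SG m w (q_mem_SG _)) _ (Fw_mem_SG m w (q_mem_SG _)) ?_
  rw [dist_Fw]
  gcongr
  exact dist_le_diam_SG (q_mem_SG _) (q_mem_SG _)

lemma posPart_sub_mul_le (a b : ℝ) :
    (max a 0 - max b 0) * (max a 0 - max b 0) ≤ (a - b) * (max a 0 - max b 0) := by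
  rcases le_total a 0 with ha | ha <;> rcases le_total b 0 with hb | hb
  · simp [ha, hb]
  · simp only [max_eq_right ha, max_eq_left hb]; nlinarith
  · simp only [max_eq_left ha, max_eq_right hb]; nlinarith
  · simp only [max_eq_left ha, max_eq_left hb]; rfl

/-- The comparison principle. If the difference `w` of two solutions were positive somewhere, the
spline that interpolates `(w - ε)⁺` on a fine grid would be an admissible test function; its energy
would be bounded by that of the pair with `w`, which is `0`. Hence `(w - ε)⁺` is constant, and
vanishes, on all fine grids. -/
theorem IsDirichletSolution.le {t : ℝ} (h0 : 0 ≤ t) {g u u' : ℝ × ℝ → ℝ}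
    (hu : IsDirichletSolution t g u) (hu' : IsDirichletSolution t g u') :
    ∀ z ∈ closedLowerDomain t, u z ≤ u' z := by
  by_contra! hcon
  obtain ⟨z₀, hz₀, hlt⟩ := hcon
  set w : ℝ × ℝ → ℝ := fun z => u z - u' z with hw
  obtain ⟨ε, hε, hεz⟩ : ∃ ε > 0, ε < w z₀ := exists_between (sub_pos.2 hlt)
  have hwc : ContinuousOn w (closedLowerDomain t) := hu.continuousOn.sub hu'.continuousOn
  have hwb : ∀ z ∈ closedLowerDomain t, ε ≤ w z → z ∈ lowerDomain t := by
    rintro z (hz | hz) h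
    · exact hz
    · exfalso
      have : w z = 0 := by simp only [hw, hu.boundary hz, hu'.boundary hz, sub_self]
      linarith
  set A : Set (ℝ × ℝ) := closedLowerDomain t ∩ w ⁻¹' Ici ε with hA
  have hAc : IsCompact A :=
    isCompact_SG.of_isClosed_subset
      (hwc.preimage_isClosed_of_isClosed (isClosed_closedLowerDomain h0) isClosed_Ici)
      (inter_subset_left.trans (closedLowerDomain_subset_SG t))
  set O : Set (ℝ × ℝ) := {z | z.2 < 1 - t} \ V 0 with hO
  have hOo : IsOpen O :=
    (isOpen_lt continuous_snd continuous_const).sdiff (V_finite 0).isClosed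
  have hOm : ∀ z ∈ SG, z ∈ O → z ∈ lowerDomain t := fun z hz h => ⟨⟨hz, h.2⟩, h.1⟩
  have hAO : A ⊆ O := fun z hz => by
    have := hwb z hz.1 hz.2
    exact ⟨this.2, this.1.2⟩
  obtain ⟨r, hr, hrO⟩ := hAc.exists_cthickening_subset_open hOo hAO
  classical
  set f : ℝ × ℝ → ℝ := fun z => if z ∈ lowerDomain t then max (w z - ε) 0 else 0 with hf
  have hfA : ∀ z, f z ≠ 0 → z ∈ A := by
    intro z hz
    simp only [hf] at hz
    split_ifs at hz with h
    · refine ⟨Or.inl h, ?_⟩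
      by_contra hlt'
      simp only [mem_preimage, mem_Ici, not_le] at hlt'
      exact hz (max_eq_right (by linarith))
    · exact absurd rfl hz
  -- the grids that are fine enough to separate `A` from the boundary
  have hfine : ∃ m₀ : ℕ, ∀ m ≥ m₀, Metric.diam SG * (1 / 2) ^ m ≤ r := by
    have h1 : Tendsto (fun m : ℕ => Metric.diam SG * (1 / 2) ^ m) atTop (𝓝 (Metric.diam SG * 0)) :=
      (tendsto_pow_atTop_nhds_zero_of_lt_one (by norm_num) (by norm_num)).const_mul _
    rw [mul_zero] at h1
    exact eventually_atTop.1 (h1.eventually_le_const hr)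
  obtain ⟨m₀, hm₀⟩ := hfine
  have hnear : ∀ m ≥ m₀, ∀ x ∈ SG, ∀ p, f p ≠ 0 → dist x p ≤ Metric.diam SG * (1 / 2) ^ m →
      x ∈ Metric.cthickening r A := fun m hm x _ p hp hd =>
    Metric.mem_cthickening_of_dist_le x p r A (hfA p hp) (hd.trans (hm₀ m hm))
  have hvanish : ∀ m ≥ m₀, ∀ p ∈ V m, f p = 0 := by
    intro m hm
    have hE : graphEnergy m w f = 0 := by
      have hsupp : ∃ K, IsCompact K ∧ K ⊆ lowerDomain t ∧ ∀ x ∈ SG \ K, spline m f x = 0 := by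
        refine ⟨Metric.cthickening r A ∩ SG, hAc.cthickening.inter_right isClosed_closure,
          fun z hz => hOm z hz.2 (hrO hz.1), fun x hx => ?_⟩
        by_contra hne
        obtain ⟨p, hp, hd⟩ := exists_of_spline_ne_zero hx.1 hne
        exact hx.2 ⟨hnear m hm x hx.1 p hp hd, hx.1⟩
      have hlim := (hu.harmonic _ (inDomEnergy_spline m f) hsupp).sub
        (hu'.harmonic _ (inDomEnergy_spline m f) hsupp)
      simp only [← graphEnergy_sub_left, sub_self] at hlim
      refine tendsto_nhds_unique (tendsto_const_nhds.congr' ?_) hlim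
      filter_upwards [eventually_ge_atTop m] with n hn
      exact (graphEnergy_spline hn w f).symm
    have hle : graphEnergy m f f ≤ graphEnergy m w f := by
      refine graphEnergy_le_of_forall fun x hx y hy hd => ?_
      by_cases hxy : f x = 0 ∧ f y = 0
      · simp [hxy.1, hxy.2]
      -- one of the two points lies in `A`, hence both lie in the domain
      have hxy' : x ∈ lowerDomain t ∧ y ∈ lowerDomain t := by
        have hself : ∀ z, f z ≠ 0 → z ∈ lowerDomain t := fun z hz =>
          hwb z (hfA z hz).1 (hfA z hz).2
        by_cases hx0 : f x = 0
        · have hy0 : f y ≠ 0 := fun h => hxy ⟨hx0, h⟩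
          exact ⟨hOm x hx (hrO (hnear m hm x hx y hy0 hd)), hself y hy0⟩
        · exact ⟨hself x hx0, hOm y hy (hrO (hnear m hm y hy x hx0 (by rwa [dist_comm])))⟩
      have := posPart_sub_mul_le (w x - ε) (w y - ε)
      simp only [hf, if_pos hxy'.1, if_pos hxy'.2]
      rwa [show w x - ε - (w y - ε) = w x - w y by ring] at this
    have hz : graphEnergy m f f = 0 := le_antisymm (hle.trans hE.le) (graphEnergy_self_nonneg m f)
    intro p hp
    rw [eq_of_graphEnergy_eq_zero hz p hp]
    exact if_neg (q_notMem_lowerDomain t 1)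
  -- vertices are dense, so there is one at which `w > ε`
  have hz₀Ω := hwb z₀ hz₀ hεz.le
  obtain ⟨U, hUo, hzU, hU⟩ := mem_nhdsWithin.1 ((hwc z₀ hz₀).eventually_const_lt hεz)
  obtain ⟨p, hpU, hpV⟩ := mem_closure_iff.1 hz₀Ω.1.1 (U ∩ O) (hUo.inter hOo)
    ⟨hzU, hz₀Ω.2, hz₀Ω.1.2⟩
  obtain ⟨m₁, hm₁⟩ := mem_iUnion.1 hpV
  have hpΩ := hOm p (V_subset_SG m₁ hm₁) hpU.2
  have hwp : ε < w p := hU ⟨hpU.1, Or.inl hpΩ⟩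
  have := hvanish (max m₀ m₁) (le_max_left _ _) p (V_mono (le_max_right _ _) hm₁)
  simp only [hf, if_pos hpΩ] at this
  have := le_max_left (w p - ε) 0
  linarith

theorem IsDirichletSolution.eqOn {t : ℝ} (h0 : 0 ≤ t) {g u u' : ℝ × ℝ → ℝ}
    (hu : IsDirichletSolution t g u) (hu' : IsDirichletSolution t g u') :
    EqOn u u' (closedLowerDomain t) :=
  fun z hz => le_antisymm (hu.le h0 hu' z hz) (hu'.le h0 hu z hz)

/-! ### The normal derivatives of `h₁` -/

lemma isH₁_h₁ {t : ℝ} (ht : t ∈ Ico (0 : ℝ) 1) : IsH₁ t (h₁ t) :=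
  Classical.epsilon_spec ⟨_, isH₁_low ht⟩

lemma iterate_F_snd {i : Fin 3} (hi : i ≠ 0) (m : ℕ) (z : ℝ × ℝ) :
    ((F i)^[m] z).2 = z.2 * (1 / 2) ^ m := by
  induction m with
  | zero => simp
  | succ m ih =>
    rw [Function.iterate_succ_apply', F_snd, ih, if_neg hi, pow_succ]
    ring

lemma normalQuotient_h₁ {t : ℝ} (ht : t ∈ Ico (0 : ℝ) 1) {i : Fin 3} (hi : i ≠ 0) :
    normalQuotient (Datum.low t 1 0).fn i =ᶠ[atTop] normalQuotient (h₁ t) i := by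
  have he := (isH₁_low ht).eqOn ht.1 (isH₁_h₁ ht)
  have hlim : Tendsto (fun m : ℕ => ((1 : ℝ) / 2) ^ m) atTop (𝓝 0) :=
    tendsto_pow_atTop_nhds_zero_of_lt_one (by norm_num) (by norm_num)
  filter_upwards [hlim.eventually_lt_const (sub_pos.2 ht.2)] with m hm
  have hmem : ∀ j, (F i)^[m] (q j) ∈ closedLowerDomain t := fun j => by
    refine mem_closedLowerDomain_of_lt ht.1 (iterate_F_mem_SG i m (q_mem_SG j)) ?_
    have h1 : (q j).2 ≤ 1 := bary_le_one_of_mem_SG (q_mem_SG j) 0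
    have h2 : (0 : ℝ) < (1 / 2) ^ m := by positivity
    rw [iterate_F_snd hi]
    nlinarith
  have hq : q i ∈ closedLowerDomain t := by
    refine mem_closedLowerDomain_of_lt ht.1 (q_mem_SG i) ?_
    have : (q i).2 = 0 := by fin_cases i <;> first | exact absurd rfl hi | rfl
    linarith [ht.2]
  simp only [normalQuotient, he (hmem _), he hq]

lemma hasNormalDeriv_one {t : ℝ} (ht : t ∈ Ico (0 : ℝ) 1) :
    HasNormalDeriv (h₁ t) 1 (etaLim t).1 := by
  obtain ⟨n, hn⟩ := Datum.normalQuotient_low_one t ht 1 0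
  refine (tendsto_const_nhds.congr' ?_).congr' (normalQuotient_h₁ ht (by decide))
  filter_upwards [eventually_ge_atTop n] with m hm
  rw [hn m hm]
  ring

lemma hasNormalDeriv_two {t : ℝ} (ht : t ∈ Ico (0 : ℝ) 1) :
    HasNormalDeriv (h₁ t) 2 (-(etaLim t).2) := by
  obtain ⟨n, hn⟩ := Datum.normalQuotient_low_two t ht 1 0
  refine (tendsto_const_nhds.congr' ?_).congr' (normalQuotient_h₁ ht (by decide))
  filter_upwards [eventually_ge_atTop n] with m hm
  rw [hn m hm]
  ring

lemma η₁_eq {t : ℝ} (ht : t ∈ Ico (0 : ℝ) 1) : η₁ t = (etaLim t).1 :=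
  (hasNormalDeriv_one ht).limUnder_eq

lemma η₂_eq {t : ℝ} (ht : t ∈ Ico (0 : ℝ) 1) : η₂ t = (etaLim t).2 := by
  rw [η₂, normalDeriv, (hasNormalDeriv_two ht).limUnder_eq, neg_neg]

end SierpinskiLower

theorem theorem4p7 :
    -- the objects are well defined: `h₁ t` is the unique solution, its normal derivatives exist
    (∀ t ∈ Ico (0 : ℝ) 1,
      IsH₁ t (h₁ t) ∧
      (∀ u, IsH₁ t u → EqOn u (h₁ t) (closedLowerDomain t)) ∧
      HasNormalDeriv (h₁ t) 1 (η₁ t) ∧ HasNormalDeriv (h₁ t) 2 (-η₂ t)) ∧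
    -- (a)
    (ContinuousOn η₁ (Ico 0 1) ∧ StrictMonoOn η₁ (Ico 0 1) ∧
      ContinuousOn η₂ (Ico 0 1) ∧ StrictAntiOn η₂ (Ico 0 1)) ∧
    -- (b)
    (∀ t ∈ Ico (0 : ℝ) 1,
      (η₁ t, η₂ t) = T (digit t 0) (η₁ (S t), η₂ (S t)) ∧
      ∀ c₁ c₂ : ℝ, 0 < c₂ → c₂ < c₁ →
        Tendsto (fun m => Tcomp t m (c₁, c₂)) atTop (𝓝 (η₁ t, η₂ t))) := by
  refine ⟨fun t ht => ⟨isH₁_h₁ ht, fun u hu => hu.eqOn ht.1 (isH₁_h₁ ht), ?_, ?_⟩,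
    ⟨?_, ?_, ?_, ?_⟩, fun t ht => ⟨?_, fun c₁ c₂ h2 h1 => ?_⟩⟩
  · rw [η₁_eq ht]; exact hasNormalDeriv_one ht
  · rw [η₂_eq ht]; exact hasNormalDeriv_two ht
  · exact (continuous_fst.comp_continuousOn continuousOn_etaLim).congr fun t ht => η₁_eq ht
  · intro t ht t' ht' h
    rw [η₁_eq ht, η₁_eq ht']
    exact (etaLim_strictMono ht ht' h).1
  · exact (continuous_snd.comp_continuousOn continuousOn_etaLim).congr fun t ht => η₂_eq ht
  · intro t ht t' ht' h
    rw [η₂_eq ht, η₂_eq ht']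
    exact (etaLim_strictMono ht ht' h).2
  · rw [η₁_eq ht, η₂_eq ht, η₁_eq (S_mem ht), η₂_eq (S_mem ht)]
    exact etaLim_eq ht
  · rw [η₁_eq ht, η₂_eq ht]
    exact tendsto_Tcomp ht h2.le h1
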